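/- Fix an integer $L\ge 0$ and put $\mathcal L=\{1,\dots,L\}$. Let $X$ be a random variable in a finite alphabet $\mathcal X$ and, for every nonempty $S\subseteq\mathcal L$, let $d_S:\mathcal X\times\hat{\mathcal X}_S\to\mathbb R$ be a distortion measure with finite reproduction alphabet $\hat{\mathcal X}_S$. Consider tuples $(R_l,D_S : l\in\mathcal L,\ \emptyset\ne S\subseteq\mathcal L)\in\mathbb R^{L+2^L-1}$. Entropies are in bits, all auxiliary random variables are finite-valued and jointly distributed with $X$, and $\{U\}_{\mathcal S}$ denotes $(U_K)_{K\in\mathcal S}$, $2^S$ the power set of $S$. The Venkataramani–Kramer–Goyal region $\mathcal{RD}_{VKG}$ is the closure of the set of tuples for which there are random variables $V_{\mathcal L}$ and $U_K$ ($\emptyset\ne K\subseteq\mathcal L$) and functions $\psi_S$ such that, for every nonempty $S\subseteq\mathcal L$, $$\sum_{l\in S}R_l\ \ge\ |S|\,I(X;V_{\mathcal L})-H(\{U\}_{2^S-\emptyset}\mid X,V_{\mathcal L})+\sum_{\emptyset\ne K\subseteq S}H(U_K\mid \{U\}_{2^K-\emptyset-\{K\}},V_{\mathcal L}),$$ $$D_S\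 \ge\ E\big[d_S(X,\psi_S(V_{\mathcal L},\{U\}_{2^S-\emptyset}))\big].$$ For the combinatorial message sharing (CMS) region put $\mathcal I_W=\{S\subseteq\mathcal L:|S|=W\}$, $\mathcal I_{W+}=\{S\subseteq\mathcal L:|S|>W\}$, $\mathcal I_{W+}(B)=\{S\in\mathcal I_{W+}:B\subseteq S\}$ and $\mathcal J(K)=\{S\subseteq\mathcal L:|S|>1,\ S\cap K\ne\emptyset\}$. Given random variables $V_S$ ($|S|>1$) and $U_K$ ($K\neq\emptyset$), let $$\alpha_W(\mathcal Q)=\sum_{S\in\mathcal Q}H(V_S\mid\{V\}_{\mathcal I_{W+}(S)})-H(\{V\}_{\mathcal Q}\mid\{V\}_{\mathcal I_{W+}},X)\qquad(\mathcal Q\subseteq\mathcal I_W),$$ $$\beta(S)=\sum_{\emptyset\ne K\subseteq S}H(U_K\mid\{U\}_{2^K-\emptyset-\{K\}},\{V\}_{\mathcal J(K)})-H(\{U\}_{2^S-\emptyset}\mid\{V\}_{\mathcal I_{1+}},X).$$ The region $\mathcal{RD}_{CMS}$ is the closure of the set of tuples for which there are such random variables, functions $\psi_S$, and real numbers $R'_l$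 ($l\in\mathcal L$), $R''_K$ ($|K|>1$) with $\sum_{K\in\mathcal Q}R''_K>\alpha_W(\mathcal Q)$ for all $2\le W\le L$ and all nonempty $\mathcal Q\subseteq\mathcal I_W$, $\sum_{l\in S}R'_l>\beta(S)$ for all nonempty $S\subseteq\mathcal L$, $R_l\ge R'_l+\sum_{K\in\mathcal J(\{l\})}R''_K$ for all $l$, and $D_S\ge E\big[d_S(X,\psi_S(\{V\}_{\mathcal J(S)},\{U\}_{2^S-\emptyset}))\big]$ for all nonempty $S\subseteq\mathcal L$. Theorem. (i) For every $L$, every finite-alphabet source and all distortion measures as above, $\mathcal{RD}_{VKG}\subseteq\mathcal{RD}_{CMS}$. (ii) The inclusion can be strict. Specifically, for every $L>2$, if $X$ is Bernoulli$(1/2)$ on $\{0,1\}$, $\hat{\mathcal X}_S=\{0,1\}$ and $d_S$ is the Hamming distortion for every $S$, then $\mathcal{RD}_{VKG}\subsetneq\mathcal{RD}_{CMS}$. -/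

import Mathlib

open scoped BigOperators

universe u v

noncomputable section

namespace MDC

/-! ### Shannon information measures (in bits) of finite-valued random variables -/

/-- `P(Z = a)` for a random variable `Z` on the discrete probability space `(Ω, P)`. -/
def prob {Ω : Type*} {A : Type*} (P : PMF Ω) (Z : Ω → A) (a : A) : ℝ :=
  ((P.map Z) a).toReal

/-- Entropy `H(Z) = -∑ₐ P(Z = a) log₂ P(Z = a)`, with `0 log 0 = 0`. -/
def entropy {Ω : Type*} {A : Type*} [Fintype A] (P : PMF Ω) (Z : Ω → A) : ℝ :=
  -(∑ a, prob P Z a * Real.logb 2 (prob P Z a))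

/-- Conditional entropy
`H(Y | Z) = -∑_z ∑_y P(Y = y, Z = z) log₂ (P(Y = y, Z = z) / P(Z = z))`; the terms with
`P(Y = y, Z = z) = 0` vanish. -/
def condEntropy {Ω : Type*} {A : Type*} {B : Type*} [Fintype A] [Fintype B] (P : PMF Ω)
    (Y : Ω → A) (Z : Ω → B) : ℝ :=
  -(∑ z, ∑ y, prob P (fun ω => (Y ω, Z ω)) (y, z) *
    Real.logb 2 (prob P (fun ω => (Y ω, Z ω)) (y, z) / prob P Z z))

/-- Mutual information `I(Y; Z) = H(Y) - H(Y | Z)`. -/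
def mutualInfo {Ω : Type*} {A : Type*} {B : Type*} [Fintype A] [Fintype B] (P : PMF Ω)
    (Y : Ω → A) (Z : Ω → B) : ℝ :=
  entropy P Y - condEntropy P Y Z

/-- Expectation of a real random variable on a finite probability space. -/
def expect {Ω : Type*} [Fintype Ω] (P : PMF Ω) (f : Ω → ℝ) : ℝ :=
  ∑ ω, (P ω).toReal * f ω

/-- The tuple `{U}_𝒮 = (U_i : i ∈ 𝒮)` as a single random variable. -/
def tuple {Ω : Type*} {ι : Type*} {A : ι → Type*} (U : ∀ i, Ω → A i) (𝒮 : Finset ι) :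
    Ω → ∀ i : 𝒮, A i :=
  fun ω i => U i ω

/-! ### Families of sets of descriptions; the descriptions are the elements of `Fin L` -/

/-- A nonempty set of descriptions. -/
abbrev NESub (L : ℕ) : Type := {S : Finset (Fin L) // S.Nonempty}

/-- `2^𝒮 - ∅`: the nonempty subsets of `𝒮`. -/
def nonemptySubsets {L : ℕ} (S : Finset (Fin L)) : Finset (Finset (Fin L)) :=
  S.powerset.erase ∅

/-- `2^𝒮 - ∅ - {𝒮}`: the nonempty proper subsets of `𝒮`. -/
def properSubsets {L : ℕ} (S : Finset (Fin L)) : Finset (Finset (Fin L)) :=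
  (nonemptySubsets S).erase S

/-- `I_W`: the sets of exactly `W` descriptions. -/
def layer (L W : ℕ) : Finset (Finset (Fin L)) :=
  Finset.univ.filter fun S => S.card = W

/-- `I_{W+}`: the sets of more than `W` descriptions. -/
def layersAbove (L W : ℕ) : Finset (Finset (Fin L)) :=
  Finset.univ.filter fun S => W < S.card

/-- `I_{W+}(B)`: the sets of more than `W` descriptions that contain `B`. -/
def layersAboveContaining {L : ℕ} (W : ℕ) (B : Finset (Fin L)) : Finset (Finset (Fin L)) :=
  (layersAbove L W).filter fun S => B ⊆ S

/-- `J(K)`: the sets of more than one description that meet `K`. -/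
def meeting {L : ℕ} (K : Finset (Fin L)) : Finset (Finset (Fin L)) :=
  Finset.univ.filter fun S => 1 < S.card ∧ 0 < (K ∩ S).card

/-! ### Rate-distortion tuples -/

/-- Tuples `(R_l, D_S : l ∈ {1,…,L}, ∅ ≠ S ⊆ {1,…,L})`, with the usual topology of
`ℝ^(L + 2^L - 1)`. -/
abbrev RDTuple (L : ℕ) : Type := (Fin L → ℝ) × (NESub L → ℝ)

/-! ### The Venkataramani–Kramer–Goyal region -/

/-- Finite-valued auxiliary random variables of the VKG scheme, jointly distributed with the
source variable `X` of law `PX`: the common variable `V = V_ℒ` and the variables `U_K`.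
Only the `U_K` with `K` nonempty are ever used. -/
structure VKGVars (L : ℕ) {𝒳 : Type u} (PX : PMF 𝒳) where
  Ω : Type
  [fintypeΩ : Fintype Ω]
  P : PMF Ω
  X : Ω → 𝒳
  law_X : P.map X = PX
  AV : Type
  [fintypeAV : Fintype AV]
  V : Ω → AV
  AU : Finset (Fin L) → Type
  [fintypeAU : ∀ K, Fintype (AU K)]
  U : ∀ K, Ω → AU K

attribute [instance] VKGVars.fintypeΩ VKGVars.fintypeAV VKGVars.fintypeAU

/-- The lower bound on `∑_{l ∈ S} R_l`:
`|S| I(X; V) - H({U}_{2^S - ∅} | X, V) + ∑_{∅ ≠ K ⊆ S} H(U_K | {U}_{2^K - ∅ - K}, V)`. -/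
def VKGVars.rateBound {L : ℕ} {𝒳 : Type u} [Fintype 𝒳] {PX : PMF 𝒳} (q : VKGVars L PX)
    (S : Finset (Fin L)) : ℝ :=
  (S.card : ℝ) * mutualInfo q.P q.X q.V
    - condEntropy q.P (tuple q.U (nonemptySubsets S)) (fun ω => (q.X ω, q.V ω))
    + ∑ K ∈ nonemptySubsets S,
        condEntropy q.P (q.U K) (fun ω => (tuple q.U (properSubsets K) ω, q.V ω))

/-- The tuples given by some VKG auxiliary variables and decoding functions. -/
def vkgAchievable {L : ℕ} {𝒳 : Type u} [Fintype 𝒳] (PX : PMF 𝒳) {Xhat : NESub L → Type v}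
    (d : ∀ S : NESub L, 𝒳 → Xhat S → ℝ) : Set (RDTuple L) :=
  {t | ∃ (q : VKGVars L PX)
      (ψ : ∀ S : NESub L, q.AV × (∀ K : nonemptySubsets S.1, q.AU K) → Xhat S),
      (∀ S : NESub L, ∑ l ∈ S.1, t.1 l ≥ q.rateBound S.1) ∧
      (∀ S : NESub L, t.2 S ≥
        expect q.P fun ω => d S (q.X ω) (ψ S (q.V ω, tuple q.U (nonemptySubsets S.1) ω)))}

/-- The region `RD_VKG` of a source with law `PX` under distortion measures `d_S`. -/
def RDVKG {L : ℕ} {𝒳 : Type u} [Fintype 𝒳] (PX : PMF 𝒳) {Xhat : NESub L → Type v}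
    (d : ∀ S : NESub L, 𝒳 → Xhat S → ℝ) : Set (RDTuple L) :=
  closure (vkgAchievable PX d)

/-! ### The region of combinatorial message sharing -/

/-- Finite-valued auxiliary random variables of the CMS scheme, jointly distributed with the
source variable `X` of law `PX`: the shared variables `V_S` and the variables `U_K`.
Only the `V_S` with `|S| > 1` and the `U_K` with `K` nonempty are ever used. -/
structure CMSVars (L : ℕ) {𝒳 : Type u} (PX : PMF 𝒳) where
  Ω : Type
  [fintypeΩ : Fintype Ω]
  P : PMF Ω
  X : Ω → 𝒳
  law_X : P.map X = PX
  AV : Finset (Fin L) → Type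
  [fintypeAV : ∀ S, Fintype (AV S)]
  V : ∀ S, Ω → AV S
  AU : Finset (Fin L) → Type
  [fintypeAU : ∀ K, Fintype (AU K)]
  U : ∀ K, Ω → AU K

attribute [instance] CMSVars.fintypeΩ CMSVars.fintypeAV CMSVars.fintypeAU

/-- `α_W(Q) = ∑_{S ∈ Q} H(V_S | {V}_{I_{W+}(S)}) - H({V}_Q | {V}_{I_{W+}}, X)`. -/
def CMSVars.α {L : ℕ} {𝒳 : Type u} [Fintype 𝒳] {PX : PMF 𝒳} (q : CMSVars L PX)
    (W : ℕ) (Q : Finset (Finset (Fin L))) : ℝ :=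
  (∑ S ∈ Q, condEntropy q.P (q.V S) (tuple q.V (layersAboveContaining W S)))
    - condEntropy q.P (tuple q.V Q) (fun ω => (tuple q.V (layersAbove L W) ω, q.X ω))

/-- `β(S) = ∑_{∅ ≠ K ⊆ S} H(U_K | {U}_{2^K - ∅ - {K}}, {V}_{J(K)})
  - H({U}_{2^S - ∅} | {V}_{I_{1+}}, X)`. -/
def CMSVars.β {L : ℕ} {𝒳 : Type u} [Fintype 𝒳] {PX : PMF 𝒳} (q : CMSVars L PX)
    (S : Finset (Fin L)) : ℝ :=
  (∑ K ∈ nonemptySubsets S,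
      condEntropy q.P (q.U K)
        (fun ω => (tuple q.U (properSubsets K) ω, tuple q.V (meeting K) ω)))
    - condEntropy q.P (tuple q.U (nonemptySubsets S))
        (fun ω => (tuple q.V (layersAbove L 1) ω, q.X ω))

/-- The tuples given by some CMS auxiliary variables, decoding functions, rates `R'_l` of the
private messages and rates `R''_K`, `|K| > 1`, of the shared messages. -/
def cmsAchievable {L : ℕ} {𝒳 : Type u} [Fintype 𝒳] (PX : PMF 𝒳) {Xhat : NESub L → Type v}
    (d : ∀ S : NESub L, 𝒳 → Xhat S → ℝ) : Set (RDTuple L) :=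
  {t | ∃ (q : CMSVars L PX)
      (ψ : ∀ S : NESub L,
        (∀ T : meeting S.1, q.AV T) × (∀ K : nonemptySubsets S.1, q.AU K) → Xhat S)
      (R' : Fin L → ℝ) (R'' : Finset (Fin L) → ℝ),
      (∀ W : ℕ, 2 ≤ W → W ≤ L → ∀ Q : Finset (Finset (Fin L)), Q ⊆ layer L W → Q.Nonempty →
        ∑ K ∈ Q, R'' K > q.α W Q) ∧
      (∀ S : NESub L, ∑ l ∈ S.1, R' l > q.β S.1) ∧
      (∀ l : Fin L, t.1 l ≥ R' l + ∑ K ∈ meeting {l}, R'' K) ∧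
      (∀ S : NESub L, t.2 S ≥ expect q.P fun ω =>
        d S (q.X ω) (ψ S (tuple q.V (meeting S.1) ω, tuple q.U (nonemptySubsets S.1) ω)))}

/-- The region `RD_CMS` of a source with law `PX` under distortion measures `d_S`. -/
def RDCMS {L : ℕ} {𝒳 : Type u} [Fintype 𝒳] (PX : PMF 𝒳) {Xhat : NESub L → Type v}
    (d : ∀ S : NESub L, 𝒳 → Xhat S → ℝ) : Set (RDTuple L) :=
  closure (cmsAchievable PX d)

/-! ### The binary symmetric source -/

/-- The Bernoulli(1/2) law on `Bool`. -/
def bernHalf : PMF Bool := PMF.uniformOfFintype Bool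

/-- Hamming distortion on binary letters, the same for every set of received descriptions. -/
def hamming (L : ℕ) : NESub L → Bool → Bool → ℝ :=
  fun _ x y => if x = y then 0 else 1

end MDC

end

/-! Inclusion. VKG shares a single variable among all descriptions. For `L ≥ 2` this is CMS with
every shared variable constant except the one indexed by the full set: its message has rate
`I(X;V)`, which each description carries in full, and subtracting it from each `R_l` leaves the
private rates (`mem_RDCMS_of_singleShared`). For `L ≤ 1` no shared index exists, and `V` is absorbed
into the private variables. The strict inequalities of CMS cost nothing because the region is
closed.

Strictness. Let descriptions `a, b` carry positive rate and reproduce the source exactly together,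
while a third description `c` has rate zero. CMS can share a variable between `a` and `b` only. In
VKG every description pays `I(X;V)`, so `R_c = 0` makes `V` useless.

Quantitatively, the VKG sum rate of `a, b` is `2 I(X;V) + H(X|V) - H(X|U,V) + I(U_a;U_b|V)`. When
`X` is a fair bit this is at least `1 - H(X|U,V) + I(A;B|V)`, with `A, B` the two individual
reconstructions, and Fano's inequality removes the middle term as `D_ab → 0`. If `A` and `B` both
have small error against a fair bit, they are correlated, and Pinsker's inequality converts the
covariance into mutual information. This gives `I(A;B|V) + D_a + D_b ≥ 9/25` up to a correction for
the dependence of `X` on `V`. Points of the closure are only limits of achievable ones, so `I(X;V)`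
merely tends to zero: the correction is `ε + I(X;V)/(2ε)`, where first `R_c → 0` and then `ε → 0`.
Hence `R_a + R_b + D_a + D_b ≥ 34/25 = 1.36` (`RDVKG_bernHalf_tradeoff`).

A Zhang–Berger type channel with a variable shared by `a, b` attains rates `0.529` and distortions
`0.15`, with total `1.358` (`exists_mem_RDCMS_bernHalf`). -/

namespace MDC

/-! ### Entropy calculus on a finite probability space -/

section Entropy

open Classical in
theorem prob_eq_sum {Ω A : Type*} [Fintype Ω] (P : PMF Ω) (Z : Ω → A) (a : A) :
    prob P Z a = ∑ ω, if Z ω = a then (P ω).toReal else 0 := by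
  rw [prob, PMF.map_apply, tsum_fintype, ENNReal.toReal_sum]
  · refine Finset.sum_congr rfl fun ω _ => ?_
    by_cases h : Z ω = a
    · simp [h]
    · simp [h, Ne.symm h]
  · intro ω _
    split_ifs
    · exact P.apply_ne_top ω
    · simp

theorem sum_toReal_pmf {Ω : Type*} [Fintype Ω] (P : PMF Ω) : ∑ ω, (P ω).toReal = 1 := by
  have h := P.tsum_coe
  rw [tsum_fintype] at h
  rw [← ENNReal.toReal_sum fun ω _ => P.apply_ne_top ω, h, ENNReal.toReal_one]

theorem prob_nonneg {Ω A : Type*} (P : PMF Ω) (Z : Ω → A) (a : A) : 0 ≤ prob P Z a :=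
  ENNReal.toReal_nonneg

theorem sum_prob_mul {Ω A : Type*} [Fintype Ω] [Fintype A] (P : PMF Ω) (Z : Ω → A) (F : A → ℝ) :
    ∑ a, prob P Z a * F a = ∑ ω, (P ω).toReal * F (Z ω) := by
  classical
  simp_rw [prob_eq_sum, Finset.sum_mul]
  rw [Finset.sum_comm]
  refine Finset.sum_congr rfl fun ω _ => ?_
  rw [Finset.sum_eq_single (Z ω)]
  · simp
  · intro b _ hb
    simp [Ne.symm hb]
  · simp

theorem sum_prob {Ω A : Type*} [Fintype Ω] [Fintype A] (P : PMF Ω) (Z : Ω → A) :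
    ∑ a, prob P Z a = 1 := by
  simpa [sum_toReal_pmf] using sum_prob_mul P Z fun _ => 1

theorem prob_congr {Ω A B : Type*} [Fintype Ω] (P : PMF Ω) {Y : Ω → A} {Z : Ω → B} {a : A} {b : B}
    (h : ∀ ω, Y ω = a ↔ Z ω = b) : prob P Y a = prob P Z b := by
  classical
  simp_rw [prob_eq_sum, h]

theorem prob_eq_sum_prob_pair {Ω A B : Type*} [Fintype Ω] [Fintype B] (P : PMF Ω)
    (Y : Ω → A) (Z : Ω → B) (a : A) :
    prob P Y a = ∑ b, prob P (fun ω => (Y ω, Z ω)) (a, b) := by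
  classical
  simp_rw [prob_eq_sum, Prod.mk.injEq]
  rw [Finset.sum_comm]
  refine Finset.sum_congr rfl fun ω _ => ?_
  simp only [ite_and]
  split_ifs <;> simp

/-- Entropy as the expected surprisal `-E log₂ P(Z)`; the alphabet of `Z` need not be finite. -/
noncomputable def ent {Ω A : Type*} [Fintype Ω] (P : PMF Ω) (Z : Ω → A) : ℝ :=
  -∑ ω, (P ω).toReal * Real.logb 2 (prob P Z (Z ω))

theorem entropy_eq_ent {Ω A : Type*} [Fintype Ω] [Fintype A] (P : PMF Ω) (Z : Ω → A) :
    entropy P Z = ent P Z := by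
  rw [entropy, ent, sum_prob_mul P Z fun a => Real.logb 2 (prob P Z a)]

theorem prob_mono {Ω A B : Type*} [Fintype Ω] (P : PMF Ω) {Y : Ω → A} {Z : Ω → B} (ω : Ω)
    (h : ∀ ω', Z ω' = Z ω → Y ω' = Y ω) : prob P Z (Z ω) ≤ prob P Y (Y ω) := by
  classical
  rw [prob_eq_sum, prob_eq_sum]
  refine Finset.sum_le_sum fun ω' _ => ?_
  by_cases hz : Z ω' = Z ω
  · simp [hz, h ω' hz]
  · simp only [hz, if_false]
    split_ifs
    · exact ENNReal.toReal_nonneg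
    · exact le_rfl

theorem toReal_le_prob {Ω A : Type*} [Fintype Ω] (P : PMF Ω) (Z : Ω → A) (ω : Ω) :
    (P ω).toReal ≤ prob P Z (Z ω) := by
  classical
  rw [prob_eq_sum]
  refine le_trans (by simp) (Finset.single_le_sum (f := fun ω' =>
    if Z ω' = Z ω then (P ω').toReal else 0) (fun ω' _ => ?_) (Finset.mem_univ ω))
  split_ifs
  · exact ENNReal.toReal_nonneg
  · exact le_rfl

theorem prob_pos {Ω A : Type*} [Fintype Ω] (P : PMF Ω) (Z : Ω → A) {ω : Ω}
    (h : 0 < (P ω).toReal) : 0 < prob P Z (Z ω) :=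
  h.trans_le (toReal_le_prob P Z ω)

/-- Entropy sees only the partition of `Ω` into level sets. All regroupings and permutations of
tuples below reduce to this. -/
theorem ent_congr {Ω A B : Type*} [Fintype Ω] (P : PMF Ω) {Y : Ω → A} {Z : Ω → B}
    (h : ∀ ω ω', Y ω' = Y ω ↔ Z ω' = Z ω) : ent P Y = ent P Z := by
  classical
  simp only [ent, prob_eq_sum]
  simp_rw [h]

/-- A function of `Z` has at most the entropy of `Z`. -/
theorem ent_mono {Ω A B : Type*} [Fintype Ω] (P : PMF Ω) {Y : Ω → A} {Z : Ω → B}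
    (h : ∀ ω ω', Z ω' = Z ω → Y ω' = Y ω) : ent P Y ≤ ent P Z := by
  refine neg_le_neg (Finset.sum_le_sum fun ω _ => ?_)
  rcases (ENNReal.toReal_nonneg (a := P ω)).eq_or_lt with h0 | h0
  · simp [← h0]
  · exact mul_le_mul_of_nonneg_left (Real.logb_le_logb_of_le (by norm_num) (prob_pos P Z h0)
      (prob_mono P ω (h ω))) h0.le

theorem ent_const {Ω A : Type*} [Fintype Ω] (P : PMF Ω) (Z : Ω → A)
    (h : ∀ ω ω', Z ω' = Z ω) : ent P Z = 0 := by
  classical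
  have : ∀ ω, prob P Z (Z ω) = 1 := fun ω => by
    rw [prob_eq_sum]
    simp_rw [h ω, if_true]
    exact sum_toReal_pmf P
  simp [ent, this]

/-- The chain rule. It reduces every rate expression to joint entropies, so that the rate
inequalities become linear. -/
theorem condEntropy_eq {Ω A B : Type*} [Fintype Ω] [Fintype A] [Fintype B] (P : PMF Ω)
    (Y : Ω → A) (Z : Ω → B) :
    condEntropy P Y Z = ent P (fun ω => (Y ω, Z ω)) - ent P Z := by
  have h := sum_prob_mul P (fun ω => (Y ω, Z ω)) fun a =>
    Real.logb 2 (prob P (fun ω => (Y ω, Z ω)) a / prob P Z a.2)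
  rw [Fintype.sum_prod_type_right] at h
  rw [condEntropy, h, ent, ent, ← neg_add', ← sub_eq_add_neg, ← Finset.sum_sub_distrib]
  congr 1
  refine Finset.sum_congr rfl fun ω _ => ?_
  rcases (ENNReal.toReal_nonneg (a := P ω)).eq_or_lt with h0 | h0
  · simp [← h0]
  · rw [Real.logb_div (prob_pos P (fun ω => (Y ω, Z ω)) h0).ne' (prob_pos P Z h0).ne', mul_sub]

theorem mutualInfo_eq {Ω A B : Type*} [Fintype Ω] [Fintype A] [Fintype B] (P : PMF Ω)
    (Y : Ω → A) (Z : Ω → B) :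
    mutualInfo P Y Z = ent P Y + ent P Z - ent P (fun ω => (Y ω, Z ω)) := by
  rw [mutualInfo, entropy_eq_ent, condEntropy_eq]
  ring

/-- The sum of `P(ω) / P(Z = Z ω)` over one class of `Z`, or over a part of it, is at most one. -/
theorem sum_class_div_le_one {Ω A : Type*} [Fintype Ω] (P : PMF Ω) (Z : Ω → A)
    (p : Ω → Prop) [DecidablePred p] (hp : ∀ ω ω', p ω → p ω' → Z ω' = Z ω) :
    ∑ ω, (if p ω then (P ω).toReal / prob P Z (Z ω) else 0) ≤ 1 := by
  classical
  by_cases hne : ∃ ω₀, p ω₀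
  · obtain ⟨ω₀, h₀⟩ := hne
    calc ∑ ω, (if p ω then (P ω).toReal / prob P Z (Z ω) else 0)
        ≤ ∑ ω, (if Z ω = Z ω₀ then (P ω).toReal else 0) / prob P Z (Z ω₀) := by
          refine Finset.sum_le_sum fun ω _ => ?_
          by_cases h : p ω
          · simp [h, hp ω₀ ω h₀ h]
          · simp only [h, if_false]
            refine div_nonneg ?_ (prob_nonneg _ _ _)
            split_ifs
            · exact ENNReal.toReal_nonneg
            · exact le_rfl
      _ = prob P Z (Z ω₀) / prob P Z (Z ω₀) := by rw [← Finset.sum_div, ← prob_eq_sum]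
      _ ≤ 1 := div_self_le_one _
  · push Not at hne
    simp [hne]

/-- Strong subadditivity: `H(A, B, C) + H(C) ≤ H(A, C) + H(B, C)`. The hypotheses say that `AC`,
`BC` determine `C`, and that together they are equivalent to `ABC`. -/
theorem ent_submodular {Ω A B C D : Type*} [Fintype Ω] (P : PMF Ω) {S : Ω → A} {T : Ω → B}
    {M : Ω → C} {J : Ω → D} (hS : ∀ ω ω', S ω' = S ω → M ω' = M ω)
    (hT : ∀ ω ω', T ω' = T ω → M ω' = M ω)
    (hJ : ∀ ω ω', S ω' = S ω → T ω' = T ω → J ω' = J ω) :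
    ent P J + ent P M ≤ ent P S + ent P T := by
  classical
  set p : Ω → ℝ := fun ω => (P ω).toReal with hp
  have hp0 : ∀ ω, 0 ≤ p ω := fun ω => ENNReal.toReal_nonneg
  -- The fraction compares the law making `S` and `T` conditionally independent given `M` with the
  -- actual law of `J`; its mean is therefore at most one.
  have key : ∑ ω, p ω * (prob P S (S ω) * prob P T (T ω) / (prob P J (J ω) * prob P M (M ω)))
      ≤ 1 := by
    -- Both probabilities are expanded over representatives `ω₁, ω₂` of the classes of `S` and `T`.
    -- The test `M ω₂ = M ω₁` is automatic there, and it keeps the sum bounded once `ω` has been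
    -- summed out.
    have h1 : ∀ ω, p ω * (prob P S (S ω) * prob P T (T ω) /
        (prob P J (J ω) * prob P M (M ω))) =
        ∑ ω₁, ∑ ω₂, (if M ω₂ = M ω₁ then p ω₁ * p ω₂ / prob P M (M ω₁) else 0) *
          (if S ω = S ω₁ ∧ T ω = T ω₂ then p ω / prob P J (J ω) else 0) := by
      intro ω
      have e1 : prob P S (S ω) = ∑ ω₁, if S ω₁ = S ω then p ω₁ else 0 := prob_eq_sum _ _ _
      have e2 : prob P T (T ω) = ∑ ω₂, if T ω₂ = T ω then p ω₂ else 0 := prob_eq_sum _ _ _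
      rw [e1, e2, Finset.sum_mul_sum, Finset.sum_div, Finset.mul_sum]
      refine Finset.sum_congr rfl fun ω₁ _ => ?_
      rw [Finset.sum_div, Finset.mul_sum]
      refine Finset.sum_congr rfl fun ω₂ _ => ?_
      by_cases ha : S ω₁ = S ω
      · by_cases hb : T ω₂ = T ω
        · have m1 := hS _ _ ha
          have m2 := hT _ _ hb
          simp only [ha, hb, m1, m2, if_true, and_self]
          simp only [div_eq_mul_inv, mul_inv]
          ring
        · simp [hb, Ne.symm hb]
      · simp [ha, Ne.symm ha]
    calc ∑ ω, p ω * (prob P S (S ω) * prob P T (T ω) / (prob P J (J ω) * prob P M (M ω)))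
        = ∑ ω₁, ∑ ω₂, (if M ω₂ = M ω₁ then p ω₁ * p ω₂ / prob P M (M ω₁) else 0) *
          ∑ ω, (if S ω = S ω₁ ∧ T ω = T ω₂ then p ω / prob P J (J ω) else 0) := by
          simp_rw [h1, Finset.mul_sum]
          rw [Finset.sum_comm]
          refine Finset.sum_congr rfl fun ω₁ _ => ?_
          rw [Finset.sum_comm]
      _ ≤ ∑ ω₁, ∑ ω₂, (if M ω₂ = M ω₁ then p ω₁ * p ω₂ / prob P M (M ω₁) else 0) := by
          refine Finset.sum_le_sum fun ω₁ _ => Finset.sum_le_sum fun ω₂ _ => ?_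
          refine mul_le_of_le_one_right ?_ (sum_class_div_le_one P J _ ?_)
          · split_ifs
            · exact div_nonneg (mul_nonneg (hp0 _) (hp0 _)) (prob_nonneg _ _ _)
            · exact le_rfl
          · rintro ω ω' ⟨a, b⟩ ⟨c, d⟩
            exact hJ ω ω' (c.trans a.symm) (d.trans b.symm)
      _ ≤ ∑ ω₁, p ω₁ := by
          refine Finset.sum_le_sum fun ω₁ _ => ?_
          have : ∀ ω₂, (if M ω₂ = M ω₁ then p ω₁ * p ω₂ / prob P M (M ω₁) else 0) =
              p ω₁ / prob P M (M ω₁) * (if M ω₂ = M ω₁ then p ω₂ else 0) := fun ω₂ => by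
            split_ifs
            · ring
            · ring
          simp_rw [this]
          rw [← Finset.mul_sum, ← prob_eq_sum, div_mul_eq_mul_div, mul_div_assoc]
          exact mul_le_of_le_one_right (hp0 _) (div_self_le_one _)
      _ = 1 := sum_toReal_pmf P
  -- Pointwise `log z ≤ z - 1`, which makes the mean of the logarithm at most the mean ratio minus
  -- one.
  have h2 : ∀ ω, p ω * (Real.logb 2 (prob P S (S ω)) + Real.logb 2 (prob P T (T ω)) -
      Real.logb 2 (prob P J (J ω)) - Real.logb 2 (prob P M (M ω))) ≤
      (p ω * (prob P S (S ω) * prob P T (T ω) / (prob P J (J ω) * prob P M (M ω))) - p ω) /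
        Real.log 2 := by
    intro ω
    rcases (hp0 ω).eq_or_lt with h0 | h0
    · simp [← h0]
    · have a := prob_pos P S h0
      have b := prob_pos P T h0
      have c := prob_pos P J h0
      have d := prob_pos P M h0
      have hl := Real.log_le_sub_one_of_pos (div_pos (mul_pos a b) (mul_pos c d))
      rw [Real.log_div (mul_pos a b).ne' (mul_pos c d).ne', Real.log_mul a.ne' b.ne',
        Real.log_mul c.ne' d.ne'] at hl
      have e : Real.logb 2 (prob P S (S ω)) + Real.logb 2 (prob P T (T ω)) -
          Real.logb 2 (prob P J (J ω)) - Real.logb 2 (prob P M (M ω)) =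
          (Real.log (prob P S (S ω)) + Real.log (prob P T (T ω)) -
            (Real.log (prob P J (J ω)) + Real.log (prob P M (M ω)))) / Real.log 2 := by
        simp only [Real.logb]
        ring
      rw [e, ← mul_div_assoc]
      refine div_le_div_of_nonneg_right ?_ (Real.log_nonneg (by norm_num))
      calc _ ≤ p ω * (prob P S (S ω) * prob P T (T ω) /
            (prob P J (J ω) * prob P M (M ω)) - 1) := mul_le_mul_of_nonneg_left hl h0.le
        _ = _ := by ring
  have h3 := Finset.sum_le_sum fun ω (_ : ω ∈ Finset.univ) => h2 ω
  rw [← Finset.sum_div, Finset.sum_sub_distrib, sum_toReal_pmf P] at h3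
  have h4 := h3.trans (div_nonpos_of_nonpos_of_nonneg (sub_nonpos.2 key)
    (Real.log_nonneg (by norm_num : (1 : ℝ) ≤ 2)))
  simp only [mul_sub, mul_add, Finset.sum_sub_distrib, Finset.sum_add_distrib] at h4
  simp only [ent]
  linarith

end Entropy

/-! ### Pinsker-type inequalities and the covariance–error trade-off -/

section Scalar

/-- This is `u log u - u + 1 ≥ 3 (u - 1)² / (2 (u + 2))` divided by `u`, the pointwise inequality
behind Pinsker. The difference of the two sides has derivative `(u - 1)³ / (u² (u + 2)²)`, so its
minimum is the value `0` at `u = 1`. -/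
theorem le_log_of_pos {u : ℝ} (hu : 0 < u) :
    (u - 1) * (5 * u + 1) / (2 * u * (u + 2)) ≤ Real.log u := by
  let g : ℝ → ℝ := fun u => Real.log u - (u - 1) * (5 * u + 1) / (2 * u * (u + 2))
  have hg : ∀ x : ℝ, 0 < x → HasDerivAt g ((x - 1) ^ 3 / (x ^ 2 * (x + 2) ^ 2)) x := by
    intro x hx
    have h1 : HasDerivAt (fun u : ℝ => (u - 1) * (5 * u + 1))
        (1 * (5 * x + 1) + (x - 1) * (5 * 1)) x :=
      ((hasDerivAt_id x).sub_const 1).mul (((hasDerivAt_id x).const_mul 5).add_const 1)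
    have h2 : HasDerivAt (fun u : ℝ => 2 * u * (u + 2)) (2 * 1 * (x + 2) + 2 * x * 1) x :=
      ((hasDerivAt_id x).const_mul 2).mul ((hasDerivAt_id x).add_const 2)
    have h3 := (Real.hasDerivAt_log hx.ne').sub (h1.div h2 (by positivity))
    refine h3.congr_deriv ?_
    field_simp
    ring
  have hmin : 0 ≤ g u := by
    have g1 : g 1 = 0 := by simp [g]
    have hc : ∀ s : Set ℝ, s ⊆ Set.Ioi 0 → ContinuousOn g s := fun s hs x hx =>
      (hg x (hs hx)).continuousAt.continuousWithinAt
    rcases le_total 1 u with h | h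
    · have hm : MonotoneOn g (Set.Ici 1) := by
        refine monotoneOn_of_deriv_nonneg (convex_Ici 1)
          (hc _ fun x (hx : 1 ≤ x) => zero_lt_one.trans_le hx) ?_ ?_
        · intro x hx
          rw [interior_Ici] at hx
          exact (hg x (zero_lt_one.trans hx)).differentiableAt.differentiableWithinAt
        · intro x hx
          rw [interior_Ici] at hx
          rw [(hg x (zero_lt_one.trans hx)).deriv]
          have : (0 : ℝ) ≤ x - 1 := sub_nonneg.2 (le_of_lt hx)
          positivity
      rw [← g1]
      exact hm (Set.mem_Ici.2 le_rfl) h h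
    · have hm : AntitoneOn g (Set.Ioc 0 1) := by
        refine antitoneOn_of_deriv_nonpos (convex_Ioc 0 1) (hc _ fun x hx => hx.1) ?_ ?_
        · intro x hx
          rw [interior_Ioc] at hx
          exact (hg x hx.1).differentiableAt.differentiableWithinAt
        · intro x hx
          rw [interior_Ioc] at hx
          rw [(hg x hx.1).deriv]
          refine div_nonpos_of_nonpos_of_nonneg ?_ (by positivity)
          exact Odd.pow_nonpos (by decide) (by linarith [hx.2])
      rw [← g1]
      exact hm ⟨hu, h⟩ ⟨one_pos, le_rfl⟩ h
  exact sub_nonneg.1 hmin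

/-- A quadratic lower bound for one term of a relative entropy, for every slope `t`. -/
theorem relEntropy_term_lower {m n : ℝ} (hm : 0 ≤ m) (hn : 0 ≤ n) (h0 : n = 0 → m = 0) (t : ℝ) :
    m - n + 3 / 2 * (m - n) ^ 2 * (2 * t - (m + 2 * n) * t ^ 2) ≤ m * Real.log (m / n) := by
  rcases hn.eq_or_lt with h | hn'
  · simp [h0 h.symm, ← h]
  · have hpos : 0 < m + 2 * n := by positivity
    -- Tangent bound for `y ↦ 1/y`. Being linear in `m` and `n`, it can be summed over terms with
    -- one common `t`, in place of Cauchy–Schwarz.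
    have ht : 2 * t - (m + 2 * n) * t ^ 2 ≤ 1 / (m + 2 * n) := by
      rw [le_div_iff₀ hpos]
      nlinarith [sq_nonneg ((m + 2 * n) * t - 1)]
    have h1 : m - n + 3 / 2 * (m - n) ^ 2 * (1 / (m + 2 * n)) ≤ m * Real.log (m / n) := by
      rcases hm.eq_or_lt with h | hm'
      · rw [← h]
        have : (0 : ℝ) - n + 3 / 2 * (0 - n) ^ 2 * (1 / (0 + 2 * n)) = -(n / 4) := by
          field_simp
          ring
        rw [this]
        simp only [zero_mul]
        linarith
      · have := mul_le_mul_of_nonneg_left (le_log_of_pos (div_pos hm' hn')) hm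
        refine le_trans (le_of_eq ?_) this
        field_simp
        ring
    have h2 : 3 / 2 * (m - n) ^ 2 * (2 * t - (m + 2 * n) * t ^ 2) ≤
        3 / 2 * (m - n) ^ 2 * (1 / (m + 2 * n)) :=
      mul_le_mul_of_nonneg_left ht (by positivity)
    linarith

theorem mul_log_div_mul {m a b c : ℝ} (hm : 0 ≤ m) (ha : m ≤ a) (hb : m ≤ b) (hc : m ≤ c) :
    m * Real.log (m / (a * b / c)) =
      m * Real.log m + m * Real.log c - m * Real.log a - m * Real.log b := by
  rcases hm.eq_or_lt with h | h
  · simp [← h]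
  · have ha' := h.trans_le ha
    have hb' := h.trans_le hb
    have hc' := h.trans_le hc
    rw [Real.log_div h.ne' (by positivity), Real.log_div (by positivity) hc'.ne',
      Real.log_mul ha'.ne' hb'.ne']
    ring

/-- Mutual information (in nats) of two bits with unnormalised joint weights
`p = m₁₁, q = m₁₀, r = m₀₁, s = m₀₀`, bounded below by the squared covariance. -/
theorem mutualInfo_bits_lower {p q r s : ℝ} (hp : 0 ≤ p) (hq : 0 ≤ q) (hr : 0 ≤ r) (hs : 0 ≤ s)
    (hm : 0 < p + q + r + s) :
    8 * ((p * s - q * r) / (p + q + r + s)) ^ 2 / (p + q + r + s) ≤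
      p * Real.log p + q * Real.log q + r * Real.log r + s * Real.log s
        + (p + q + r + s) * Real.log (p + q + r + s)
        - (p + q) * Real.log (p + q) - (r + s) * Real.log (r + s)
        - (p + r) * Real.log (p + r) - (q + s) * Real.log (q + s) := by
  set m := p + q + r + s with hmdef
  have term : ∀ {z a b : ℝ}, 0 ≤ z → z ≤ a → z ≤ b → z ≤ m → ∀ t : ℝ,
      z - a * b / m + 3 / 2 * (z - a * b / m) ^ 2 * (2 * t - (z + 2 * (a * b / m)) * t ^ 2) ≤
        z * Real.log z + z * Real.log m - z * Real.log a - z * Real.log b := by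
    intro z a b hz ha hb hc t
    rw [← mul_log_div_mul hz ha hb hc]
    refine relEntropy_term_lower hz
      (div_nonneg (mul_nonneg (hz.trans ha) (hz.trans hb)) hm.le) (fun h => ?_) t
    rcases div_eq_zero_iff.1 h with h | h
    · rcases mul_eq_zero.1 h with h | h
      · exact le_antisymm (h ▸ ha) hz
      · exact le_antisymm (h ▸ hb) hz
    · exact absurd h hm.ne'
  -- All four squared deviations will equal `d²`, so the sum contains `8 t - 3 m t²`, which is
  -- largest at `t = 4 / (3 m)`.
  have t1 := term (z := p) (a := p + q) (b := p + r) hp (by linarith) (by linarith)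
    (by linarith) (4 / (3 * m))
  have t2 := term (z := q) (a := p + q) (b := q + s) hq (by linarith) (by linarith)
    (by linarith) (4 / (3 * m))
  have t3 := term (z := r) (a := r + s) (b := p + r) hr (by linarith) (by linarith)
    (by linarith) (4 / (3 * m))
  have t4 := term (z := s) (a := r + s) (b := q + s) hs (by linarith) (by linarith)
    (by linarith) (4 / (3 * m))
  set d := (p * s - q * r) / m with hd
  have e1 : p - (p + q) * (p + r) / m = d := by
    rw [hd, eq_div_iff hm.ne', sub_mul, div_mul_cancel₀ _ hm.ne', hmdef]; ring
  have e2 : q - (p + q) * (q + s) / m = -d := by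
    rw [hd, ← neg_div, eq_div_iff hm.ne', sub_mul, div_mul_cancel₀ _ hm.ne', hmdef]; ring
  have e3 : r - (r + s) * (p + r) / m = -d := by
    rw [hd, ← neg_div, eq_div_iff hm.ne', sub_mul, div_mul_cancel₀ _ hm.ne', hmdef]; ring
  have e4 : s - (r + s) * (q + s) / m = d := by
    rw [hd, eq_div_iff hm.ne', sub_mul, div_mul_cancel₀ _ hm.ne', hmdef]; ring
  rw [e1, show (p + q) * (p + r) / m = p - d by linarith] at t1
  rw [e2, show (p + q) * (q + s) / m = q + d by linarith] at t2
  rw [e3, show (r + s) * (p + r) / m = r + d by linarith] at t3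
  rw [e4, show (r + s) * (q + s) / m = s - d by linarith] at t4
  have hsum : 3 / 2 * d ^ 2 * (8 * (4 / (3 * m)) - 3 * m * (4 / (3 * m)) ^ 2) =
      8 * d ^ 2 / m := by
    field_simp
    ring
  rw [← hsum]
  have hlin : 3 / 2 * d ^ 2 * (8 * (4 / (3 * m)) - 3 * m * (4 / (3 * m)) ^ 2) =
      (d + 3 / 2 * d ^ 2 * (2 * (4 / (3 * m)) - (p + 2 * (p - d)) * (4 / (3 * m)) ^ 2)) +
      (-d + 3 / 2 * (-d) ^ 2 * (2 * (4 / (3 * m)) - (q + 2 * (q + d)) * (4 / (3 * m)) ^ 2)) +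
      (-d + 3 / 2 * (-d) ^ 2 * (2 * (4 / (3 * m)) - (r + 2 * (r + d)) * (4 / (3 * m)) ^ 2)) +
      (d + 3 / 2 * d ^ 2 * (2 * (4 / (3 * m)) - (s + 2 * (s - d)) * (4 / (3 * m)) ^ 2)) := by
    generalize 4 / (3 * m) = t
    rw [hmdef]
    ring
  rw [hlin]
  refine (add_le_add (add_le_add (add_le_add t1 t2) t3) t4).trans (le_of_eq ?_)
  generalize Real.log m = lm
  rw [hmdef]
  ring

/-- Information deficiency (in nats) of a bit with unnormalised weights `p, q`. -/
theorem deficiency_bit_lower {p q : ℝ} (hp : 0 ≤ p) (hq : 0 ≤ q) (hm : 0 < p + q) :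
    2 * ((p - q) / 2) ^ 2 / (p + q) ≤
      p * Real.log p + q * Real.log q - (p + q) * Real.log (p + q) + (p + q) * Real.log 2 := by
  set m := p + q with hmdef
  have term : ∀ {z : ℝ}, 0 ≤ z → ∀ t : ℝ,
      z - m / 2 + 3 / 2 * (z - m / 2) ^ 2 * (2 * t - (z + 2 * (m / 2)) * t ^ 2) ≤
        z * Real.log z - z * Real.log m + z * Real.log 2 := by
    intro z hz t
    refine (relEntropy_term_lower hz (half_pos hm).le (fun h => absurd h (half_pos hm).ne')
      t).trans (le_of_eq ?_)
    rcases hz.eq_or_lt with h | h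
    · simp [← h]
    · rw [Real.log_div h.ne' (half_pos hm).ne', Real.log_div hm.ne' two_ne_zero]
      ring
  -- Here the sum contains `4 t - 3 m t²`, with maximum at `t = 2 / (3 m)`.
  have t1 := term hp (2 / (3 * m))
  have t2 := term hq (2 / (3 * m))
  have hsum : 2 * ((p - q) / 2) ^ 2 / m =
      3 / 2 * ((p - q) / 2) ^ 2 * (4 * (2 / (3 * m)) - 3 * m * (2 / (3 * m)) ^ 2) := by
    field_simp
    ring
  rw [hsum]
  refine le_trans (le_of_eq ?_) ((add_le_add t1 t2).trans (le_of_eq ?_))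
  · generalize 2 / (3 * m) = t
    rw [hmdef]
    ring
  · generalize Real.log m = lm
    rw [hmdef]
    ring

/-- The trade-off between the covariance of two bits of means `x, y`, and the expected number `c`
of their errors with respect to a fair bit. -/
theorem covariance_error_tradeoff {x y s c : ℝ} (h1 : x + y - 2 * s ≤ c) (h2 : x + y - 1 ≤ c)
    (h3 : 1 - x - y ≤ c) : 9 / 25 ≤ 11 * (s - x * y) ^ 2 + c := by
  have main : ∀ x y s c : ℝ, 1 ≤ x + y → x + y - 2 * s ≤ c → x + y - 1 ≤ c →
      9 / 25 ≤ 11 * (s - x * y) ^ 2 + c := by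
    intro x y s c h0 h1 h2
    rcases le_or_gt (9 / 25) c with hc | hc
    · nlinarith [sq_nonneg (s - x * y)]
    · have hc0 : 0 ≤ c := by linarith
      -- By the first hypothesis the covariance is at least `(w - c)/2 - w²/4` with `w = x + y`.
      -- This decreases on `1 ≤ w ≤ 1 + c`, and `g` is its value at `w = 1 + c`.
      set g := 1 / 2 - (1 + c) ^ 2 / 4 with hg
      have hg0 : 0 ≤ g := by rw [hg]; nlinarith
      have hle : g ≤ s - x * y := by
        rw [hg]
        nlinarith [sq_nonneg (x - y), mul_nonneg (show (0 : ℝ) ≤ 1 + c - (x + y) by linarith)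
          (show (0 : ℝ) ≤ x + y + (1 + c) - 2 by linarith)]
      have hsq : g ^ 2 ≤ (s - x * y) ^ 2 := pow_le_pow_left₀ hg0 hle 2
      have hfin : 9 / 25 ≤ 11 * g ^ 2 + c := by
        -- `g²` is replaced by its tangents at `13/100` and `137/2000`. The resulting bounds are
        -- concave quadratics in `c`, so on each interval only the endpoints matter.
        rcases le_total c (6 / 25) with h | h
        · have : 11 * (2 * g * (13 / 100) - (13 / 100) ^ 2) ≤ 11 * g ^ 2 := by
            nlinarith [sq_nonneg (g - 13 / 100)]
          rw [hg] at this ⊢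
          nlinarith
        · have : 11 * (2 * g * (137 / 2000) - (137 / 2000) ^ 2) ≤ 11 * g ^ 2 := by
            nlinarith [sq_nonneg (g - 137 / 2000)]
          rw [hg] at this ⊢
          nlinarith
      linarith
  rcases le_total 1 (x + y) with h | h
  · exact main x y s c h h1 h2
  -- Complementing both bits preserves the covariance and exchanges the last two hypotheses.
  · have := main (1 - x) (1 - y) (1 - x - y + s) c (by linarith) (by linarith) (by linarith)
    refine this.trans (le_of_eq ?_)
    ring

end Scalar

/-! ### Conditional mutual information against reconstruction error -/

section Tradeoff

/-- Trade-off for one value of the time-sharing variable; `M a b x` are unnormalised joint weights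
of two reconstructions `a, b` and of the source bit `x`. -/
theorem bits_tradeoff {M : Bool → Bool → Bool → ℝ} (hM : ∀ a b x, 0 ≤ M a b x) {ε : ℝ}
    (hε : 0 < ε) :
    9 / 25 * (∑ a, ∑ b, ∑ x, M a b x) ≤
      ((∑ a, ∑ b, (∑ x, M a b x) * Real.log (∑ x, M a b x))
        + (∑ a, ∑ b, ∑ x, M a b x) * Real.log (∑ a, ∑ b, ∑ x, M a b x)
        - (∑ a, (∑ b, ∑ x, M a b x) * Real.log (∑ b, ∑ x, M a b x))
        - (∑ b, (∑ a, ∑ x, M a b x) * Real.log (∑ a, ∑ x, M a b x))) / Real.log 2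
      + (∑ a, ∑ b, ∑ x, M a b x * ((if x = a then 0 else 1) + (if x = b then 0 else 1)))
      + ε * (∑ a, ∑ b, ∑ x, M a b x)
      + ((∑ x, (∑ a, ∑ b, M a b x) * Real.log (∑ a, ∑ b, M a b x))
        - (∑ a, ∑ b, ∑ x, M a b x) * Real.log (∑ a, ∑ b, ∑ x, M a b x)
        + (∑ a, ∑ b, ∑ x, M a b x) * Real.log 2) / (2 * ε * Real.log 2) := by
  have hnn : 0 ≤ ∑ a, ∑ b, ∑ x, M a b x :=
    Finset.sum_nonneg fun a _ => Finset.sum_nonneg fun b _ => Finset.sum_nonneg fun x _ => hM a b x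
  rcases hnn.eq_or_lt with h0 | hm
  · have hz : ∀ a b x, M a b x = 0 := by
      have h1 := h0.symm
      simp only [Fintype.sum_bool] at h1
      intro a b x
      cases a <;> cases b <;> cases x <;>
        linarith [hM true true true, hM true true false, hM true false true, hM true false false,
          hM false true true, hM false true false, hM false false true, hM false false false]
    simp [hz]
  · have hl0 : 0 < Real.log 2 := Real.log_pos (by norm_num)
    -- Turns the Pinsker constant `8` in nats into the constant `11` in bits.
    have hl1 : Real.log 2 ≤ 8 / 11 := by linarith [Real.log_two_lt_d9]
    simp only [Fintype.sum_bool] at hm ⊢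
    simp only [if_true, Bool.true_eq_false, Bool.false_eq_true, if_false, add_zero, mul_zero,
      zero_add, mul_one]
    have c1 := hM true true true
    have c2 := hM true true false
    have c3 := hM true false true
    have c4 := hM true false false
    have c5 := hM false true true
    have c6 := hM false true false
    have c7 := hM false false true
    have c8 := hM false false false
    generalize M true true true = m1 at *
    generalize M true true false = m2 at *
    generalize M true false true = m3 at *
    generalize M true false false = m4 at *
    generalize M false true true = m5 at *
    generalize M false true false = m6 at *
    generalize M false false true = m7 at *
    generalize M false false false = m8 at *
    have hI := mutualInfo_bits_lower (add_nonneg c1 c2) (add_nonneg c3 c4) (add_nonneg c5 c6)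
      (add_nonneg c7 c8) (by linarith)
    have hK := deficiency_bit_lower (p := m1 + m3 + (m5 + m7)) (q := m2 + m4 + (m6 + m8))
      (by linarith) (by linarith) (by linarith)
    rw [show m1 + m3 + (m5 + m7) + (m2 + m4 + (m6 + m8)) =
      m1 + m2 + (m3 + m4) + (m5 + m6 + (m7 + m8)) by ring] at hK
    rw [show m1 + m2 + (m3 + m4) + (m5 + m6) + (m7 + m8) =
      m1 + m2 + (m3 + m4) + (m5 + m6 + (m7 + m8)) by ring] at hI
    set m := m1 + m2 + (m3 + m4) + (m5 + m6 + (m7 + m8)) with hmdef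
    set e := (m1 + m3 + (m5 + m7) - (m2 + m4 + (m6 + m8))) / 2 with he
    set d := ((m1 + m2) * (m7 + m8) - (m3 + m4) * (m5 + m6)) / m with hd
    -- The source bit is only nearly fair given `V`; the summand `2 * |e|` pays for its bias once
    -- for each reconstruction.
    have hT := covariance_error_tradeoff (x := (m1 + m2 + (m3 + m4)) / m)
      (y := (m1 + m2 + (m5 + m6)) / m) (s := (m1 + m2) / m)
      (c := ((m3 + m4) + (m5 + m6) + 2 * m2 + 2 * m7 + 2 * |e|) / m)
      (by
        rw [← add_div, mul_div_assoc', ← sub_div]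
        refine div_le_div_of_nonneg_right ?_ hm.le
        linarith [abs_nonneg e])
      (by
        rw [← add_div, ← div_self hm.ne', ← sub_div]
        refine div_le_div_of_nonneg_right ?_ hm.le
        linarith [le_abs_self e])
      (by
        rw [← div_self hm.ne', ← sub_div, ← sub_div]
        refine div_le_div_of_nonneg_right ?_ hm.le
        linarith [neg_abs_le e])
    have hcov : (m1 + m2) / m - (m1 + m2 + (m3 + m4)) / m * ((m1 + m2 + (m5 + m6)) / m) =
        d / m := by
      rw [hd]
      field_simp
      rw [hmdef]
      ring
    rw [hcov] at hT
    have hT' := mul_le_mul_of_nonneg_right hT hm.le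
    have hTe : (11 * (d / m) ^ 2 + ((m3 + m4) + (m5 + m6) + 2 * m2 + 2 * m7 + 2 * |e|) / m) * m =
        11 * d ^ 2 / m + ((m3 + m4) + (m5 + m6) + 2 * m2 + 2 * m7 + 2 * |e|) := by
      field_simp
    rw [hTe] at hT'
    have hI' : 11 * d ^ 2 / m ≤ 8 * d ^ 2 / m / Real.log 2 := by
      rw [le_div_iff₀ hl0]
      have : 0 ≤ d ^ 2 / m := by positivity
      calc 11 * d ^ 2 / m * Real.log 2 = 11 * (d ^ 2 / m) * Real.log 2 := by ring
        _ ≤ 11 * (d ^ 2 / m) * (8 / 11) := by gcongr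
        _ = 8 * d ^ 2 / m := by ring
    have hI'' := div_le_div_of_nonneg_right hI hl0.le
    have hK' := div_le_div_of_nonneg_right hK (show 0 ≤ 2 * ε * Real.log 2 by positivity)
    have hK'' : e ^ 2 / (ε * m) ≤ 2 * e ^ 2 / m / (2 * ε * Real.log 2) := by
      rw [le_div_iff₀ (by positivity)]
      calc e ^ 2 / (ε * m) * (2 * ε * Real.log 2) ≤ e ^ 2 / (ε * m) * (2 * ε * 1) := by
            gcongr
            linarith
        _ = 2 * e ^ 2 / m := by field_simp
    -- AM–GM trades the bias for its square, which the information deficiency of the source bit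
    -- controls.
    have habs : 2 * |e| ≤ ε * m + e ^ 2 / (ε * m) := by
      have hpos : 0 < ε * m := by positivity
      rw [← sub_nonneg]
      have : ε * m + e ^ 2 / (ε * m) - 2 * |e| = (ε * m - |e|) ^ 2 / (ε * m) := by
        rw [← sq_abs e]
        field_simp
        ring
      rw [this]
      positivity
    have hI3 : 11 * d ^ 2 / m ≤ _ := hI'.trans hI''
    have hK3 : e ^ 2 / (ε * m) ≤ _ := hK''.trans hK'
    refine (hT'.trans (add_le_add hI3 (add_le_add_right habs _))).trans ?_
    refine le_trans (add_le_add_right (add_le_add_right (add_le_add_right hK3 _) _) _)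
      (le_of_eq ?_)
    ring

theorem ent_mul_log_two {Ω A : Type*} [Fintype Ω] [Fintype A] (P : PMF Ω) (Z : Ω → A) :
    ent P Z * Real.log 2 = -∑ a, prob P Z a * Real.log (prob P Z a) := by
  rw [← entropy_eq_ent, entropy, neg_mul, Finset.sum_mul]
  congr 1
  refine Finset.sum_congr rfl fun a _ => ?_
  rw [mul_assoc, Real.logb, div_mul_cancel₀ _ (Real.log_pos (by norm_num)).ne']

/-- The trade-off averaged over a variable `V` that may depend slightly on the source bit `X`. -/
theorem condMutualInfo_tradeoff {Ω AV : Type*} [Fintype Ω] [Fintype AV] (P : PMF Ω)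
    (X A B : Ω → Bool) (V : Ω → AV) {ε : ℝ} (hε : 0 < ε) :
    9 / 25 ≤ ent P (fun ω => (V ω, A ω)) + ent P (fun ω => (V ω, B ω))
        - ent P (fun ω => (V ω, A ω, B ω)) - ent P V
      + expect P (fun ω => if X ω = A ω then 0 else 1)
      + expect P (fun ω => if X ω = B ω then 0 else 1)
      + ε + (1 + ent P V - ent P (fun ω => (V ω, X ω))) / (2 * ε) := by
  classical
  have hl0 : 0 < Real.log 2 := Real.log_pos (by norm_num)
  set W : Ω → AV × Bool × Bool × Bool := fun ω => (V ω, A ω, B ω, X ω) with hW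
  set M : AV → Bool → Bool → Bool → ℝ := fun v a b x => prob P W (v, a, b, x)
  have pVAB : ∀ v a b, prob P (fun ω => (V ω, A ω, B ω)) (v, a, b) = ∑ x, M v a b x := by
    intro v a b
    rw [prob_eq_sum_prob_pair P _ X]
    exact Finset.sum_congr rfl fun x _ => prob_congr P (by simp [hW, and_assoc])
  have pVA : ∀ v a, prob P (fun ω => (V ω, A ω)) (v, a) = ∑ b, ∑ x, M v a b x := by
    intro v a
    rw [prob_eq_sum_prob_pair P _ B]
    refine Finset.sum_congr rfl fun b _ => ?_
    rw [← pVAB]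
    exact prob_congr P (by simp [and_assoc])
  have pVB : ∀ v b, prob P (fun ω => (V ω, B ω)) (v, b) = ∑ a, ∑ x, M v a b x := by
    intro v b
    rw [prob_eq_sum_prob_pair P _ A]
    refine Finset.sum_congr rfl fun a _ => ?_
    rw [← pVAB]
    exact prob_congr P fun ω => by simp only [Prod.mk.injEq]; tauto
  have pV : ∀ v, prob P V v = ∑ a, ∑ b, ∑ x, M v a b x := by
    intro v
    rw [prob_eq_sum_prob_pair P _ A]
    exact Finset.sum_congr rfl fun a _ => pVA v a
  have pVX : ∀ v x, prob P (fun ω => (V ω, X ω)) (v, x) = ∑ a, ∑ b, M v a b x := by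
    intro v x
    rw [prob_eq_sum_prob_pair P _ A]
    refine Finset.sum_congr rfl fun a _ => ?_
    rw [prob_eq_sum_prob_pair P _ B]
    refine Finset.sum_congr rfl fun b _ => ?_
    exact prob_congr P fun ω => by simp only [hW, Prod.mk.injEq]; tauto
  have hone : ∑ v, ∑ a, ∑ b, ∑ x, M v a b x = 1 := by
    simp_rw [← pV]
    exact sum_prob P V
  have hcost : expect P (fun ω => if X ω = A ω then 0 else 1) +
      expect P (fun ω => if X ω = B ω then 0 else 1) =
      ∑ v, ∑ a, ∑ b, ∑ x, M v a b x * ((if x = a then 0 else 1) + (if x = b then 0 else 1)) := by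
    have := sum_prob_mul P W fun z =>
      (if z.2.2.2 = z.2.1 then (0 : ℝ) else 1) + (if z.2.2.2 = z.2.2.1 then 0 else 1)
    simp only [Fintype.sum_prod_type] at this
    rw [expect, expect, ← Finset.sum_add_distrib, this]
    refine Finset.sum_congr rfl fun ω _ => ?_
    rw [← mul_add]
  have hV := ent_mul_log_two P V
  have hVA := ent_mul_log_two P fun ω => (V ω, A ω)
  have hVB := ent_mul_log_two P fun ω => (V ω, B ω)
  have hVX := ent_mul_log_two P fun ω => (V ω, X ω)
  have hVAB := ent_mul_log_two P fun ω => (V ω, A ω, B ω)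
  simp only [Fintype.sum_prod_type, pV, pVA, pVB, pVX, pVAB] at hV hVA hVB hVX hVAB
  have hs := Finset.sum_le_sum fun v (_ : v ∈ Finset.univ) =>
    bits_tradeoff (M := M v) (fun a b x => prob_nonneg P W _) hε
  simp only [Finset.sum_add_distrib, ← Finset.mul_sum, ← Finset.sum_div, Finset.sum_sub_distrib,
    ← Finset.sum_mul, hone, ← hcost] at hs
  have e1 : (ent P (fun ω => (V ω, A ω)) + ent P (fun ω => (V ω, B ω))
        - ent P (fun ω => (V ω, A ω, B ω)) - ent P V) =
      (ent P (fun ω => (V ω, A ω)) * Real.log 2 + ent P (fun ω => (V ω, B ω)) * Real.log 2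
        - ent P (fun ω => (V ω, A ω, B ω)) * Real.log 2 - ent P V * Real.log 2) / Real.log 2 := by
    field_simp
  have e2 : (1 + ent P V - ent P (fun ω => (V ω, X ω))) / (2 * ε) =
      (Real.log 2 + ent P V * Real.log 2 - ent P (fun ω => (V ω, X ω)) * Real.log 2) /
        (2 * ε * Real.log 2) := by
    field_simp
  rw [e1, e2, hV, hVA, hVB, hVX, hVAB]
  refine le_trans (le_of_eq (by ring)) (hs.trans (le_of_eq ?_))
  ring

end Tradeoff

/-! ### Achievability in the CMS region -/

section Regions

theorem tuple_eq_iff {Ω ι : Type*} {A : ι → Type*} (U : ∀ i, Ω → A i) (𝒮 : Finset ι) (ω ω' : Ω) :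
    tuple U 𝒮 ω' = tuple U 𝒮 ω ↔ ∀ i ∈ 𝒮, U i ω' = U i ω := by
  simp [tuple, funext_iff]

theorem mem_nonemptySubsets {L : ℕ} {S K : Finset (Fin L)} :
    K ∈ nonemptySubsets S ↔ K.Nonempty ∧ K ⊆ S := by
  simp [nonemptySubsets, Finset.nonempty_iff_ne_empty]

theorem mem_meeting {L : ℕ} {S K : Finset (Fin L)} :
    S ∈ meeting K ↔ 1 < S.card ∧ (K ∩ S).Nonempty := by
  simp [meeting, Finset.card_pos]

theorem nonempty_of_pmf {α : Type*} (P : PMF α) : Nonempty α :=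
  P.support_nonempty.to_type

/-- The strict rate inequalities of the CMS region may be relaxed, because the region is closed. -/
theorem mem_RDCMS_of_le {L : ℕ} {𝒳 : Type u} [Fintype 𝒳] {PX : PMF 𝒳} {Xhat : NESub L → Type v}
    {d : ∀ S : NESub L, 𝒳 → Xhat S → ℝ} {t : RDTuple L} (q : CMSVars L PX)
    (ψ : ∀ S : NESub L,
      (∀ T : meeting S.1, q.AV T) × (∀ K : nonemptySubsets S.1, q.AU K) → Xhat S)
    (R' : Fin L → ℝ) (R'' : Finset (Fin L) → ℝ)
    (hα : ∀ W : ℕ, 2 ≤ W → W ≤ L → ∀ Q : Finset (Finset (Fin L)), Q ⊆ layer L W → Q.Nonempty →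
      q.α W Q ≤ ∑ K ∈ Q, R'' K)
    (hβ : ∀ S : NESub L, q.β S.1 ≤ ∑ l ∈ S.1, R' l)
    (hR : ∀ l : Fin L, R' l + ∑ K ∈ meeting {l}, R'' K ≤ t.1 l)
    (hD : ∀ S : NESub L, expect q.P (fun ω => d S (q.X ω)
      (ψ S (tuple q.V (meeting S.1) ω, tuple q.U (nonemptySubsets S.1) ω))) ≤ t.2 S) :
    t ∈ RDCMS PX d := by
  -- Every rate `R'` and `R''` is raised by `δ`. A description carries at most `N` shared messages,
  -- so its total rate grows by at most `(1 + N) δ`.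
  set N : ℝ := ∑ _K : Finset (Fin L), (1 : ℝ) with hN
  have hlim : Filter.Tendsto (fun δ : ℝ => ((fun l => t.1 l + (1 + N) * δ, t.2) : RDTuple L))
      (nhdsWithin 0 (Set.Ioi 0)) (nhds t) := by
    have hc : Continuous fun δ : ℝ => ((fun l => t.1 l + (1 + N) * δ, t.2) : RDTuple L) := by
      fun_prop
    have := hc.tendsto 0
    simp only [mul_zero, add_zero] at this
    exact this.mono_left nhdsWithin_le_nhds
  refine mem_closure_of_tendsto hlim ?_
  filter_upwards [self_mem_nhdsWithin] with δ (hδ : 0 < δ)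
  refine ⟨q, ψ, fun l => R' l + δ, fun K => R'' K + δ, ?_, ?_, ?_, hD⟩
  · intro W h2 hW Q hQ hne
    refine (hα W h2 hW Q hQ hne).trans_lt (Finset.sum_lt_sum_of_nonempty hne fun K _ => ?_)
    linarith
  · intro S
    refine (hβ S).trans_lt (Finset.sum_lt_sum_of_nonempty S.2 fun l _ => ?_)
    linarith
  · intro l
    have h1 : ∑ K ∈ meeting {l}, (R'' K + δ) ≤ ∑ K ∈ meeting {l}, R'' K + N * δ := by
      rw [Finset.sum_add_distrib, hN, Finset.sum_mul, one_mul]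
      exact add_le_add_right (Finset.sum_le_sum_of_subset_of_nonneg (Finset.subset_univ _)
        fun _ _ _ => hδ.le) _
    have := hR l
    simp only [ge_iff_le]
    linarith

/-- Achievability by a single message shared by the descriptions in `T`. -/
theorem mem_RDCMS_of_singleShared {L : ℕ} {𝒳 : Type u} [Fintype 𝒳] {PX : PMF 𝒳}
    {Xhat : NESub L → Type v} {d : ∀ S : NESub L, 𝒳 → Xhat S → ℝ} {t : RDTuple L}
    {Ω : Type} [Fintype Ω] (P : PMF Ω) (X : Ω → 𝒳) (law_X : P.map X = PX) {AV : Type} [Fintype AV]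
    (V : Ω → AV) {AU : Finset (Fin L) → Type} [∀ K, Fintype (AU K)] (U : ∀ K, Ω → AU K)
    (T : Finset (Fin L)) (hT : 1 < T.card) (g : ∀ S : NESub L, Ω → Xhat S)
    (hg : ∀ (S : NESub L) (ω ω' : Ω), ((S.1 ∩ T).Nonempty → V ω = V ω') →
      (∀ K ∈ nonemptySubsets S.1, U K ω = U K ω') → g S ω = g S ω')
    (hR : ∀ S : NESub L, ((S.1 ∩ T).card : ℝ) * (ent P X + ent P V - ent P (fun ω => (X ω, V ω)))
      + (∑ K ∈ nonemptySubsets S.1, if (K ∩ T).Nonempty then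
          ent P (fun ω => (U K ω, tuple U (properSubsets K) ω, V ω))
            - ent P (fun ω => (tuple U (properSubsets K) ω, V ω))
        else ent P (fun ω => (U K ω, tuple U (properSubsets K) ω))
            - ent P (tuple U (properSubsets K)))
      - (ent P (fun ω => (tuple U (nonemptySubsets S.1) ω, V ω, X ω))
        - ent P (fun ω => (V ω, X ω))) ≤ ∑ l ∈ S.1, t.1 l)
    (hD : ∀ S : NESub L, expect P (fun ω => d S (X ω) (g S ω)) ≤ t.2 S) :
    t ∈ RDCMS PX d := by
  classical
  obtain ⟨ω₀⟩ := nonempty_of_pmf P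
  set I := ent P X + ent P V - ent P (fun ω => (X ω, V ω)) with hI
  set V' : Finset (Fin L) → Ω → AV := fun S ω => if S = T then V ω else V ω₀ with hV'
  have hV : ∀ (𝒮 : Finset (Finset (Fin L))) (ω ω' : Ω), tuple V' 𝒮 ω' = tuple V' 𝒮 ω ↔
      (T ∈ 𝒮 → V ω' = V ω) := by
    intro 𝒮 ω ω'
    rw [tuple_eq_iff]
    constructor
    · intro h hT
      simpa [hV'] using h T hT
    · intro h S hS
      by_cases hST : S = T
      · subst hST
        simpa [hV'] using h hS
      · simp [hV', hST]
  have hTm : ∀ K : Finset (Fin L), T ∈ meeting K ↔ (K ∩ T).Nonempty := fun K => by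
    simp [mem_meeting, hT]
  -- What the receiver of `S` sees determines `g S`, so `g S` extends to a decoder on all tuples.
  have hfac : ∀ S : NESub L, Function.FactorsThrough (g S)
      fun ω => (tuple V' (meeting S.1) ω, tuple U (nonemptySubsets S.1) ω) := by
    intro S ω ω' h
    rw [Prod.mk.injEq, hV, tuple_eq_iff, hTm] at h
    exact hg S ω ω' h.1 h.2
  refine mem_RDCMS_of_le ⟨Ω, P, X, law_X, fun _ => AV, V', AU, U⟩
    (fun S => Function.extend (fun ω => (tuple V' (meeting S.1) ω,
      tuple U (nonemptySubsets S.1) ω)) (g S) fun _ => g S ω₀)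
    (fun l => t.1 l - if l ∈ T then I else 0) (fun K => if K = T then I else 0) ?_ ?_ ?_ ?_
  · intro W _ _ Q hQ _
    change (∑ S ∈ Q, condEntropy P (V' S) (tuple V' (layersAboveContaining W S))) -
      condEntropy P (tuple V' Q) (fun ω => (tuple V' (layersAbove L W) ω, X ω)) ≤ _
    simp_rw [condEntropy_eq]
    have hc : ∀ S ∈ Q, S ≠ T → ent P (fun ω => (V' S ω,
        tuple V' (layersAboveContaining W S) ω)) -
        ent P (tuple V' (layersAboveContaining W S)) = 0 := by
      intro S _ hST
      rw [sub_eq_zero]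
      refine ent_congr P fun ω ω' => ?_
      rw [Prod.mk.injEq]
      simp [hV', hST]
    by_cases hTQ : T ∈ Q
    · have hW : T.card = W := by
        have := hQ hTQ
        simpa [layer] using this
      -- No set strictly larger than `T` carries information, so the bound `α` for a family
      -- containing `T` is exactly `I(X;V)`.
      have hTa : T ∉ layersAbove L W := by simp [layersAbove, hW]
      have hTc : T ∉ layersAboveContaining W T := fun h => hTa (Finset.mem_filter.1 h).1
      rw [Finset.sum_ite_eq' Q T, if_pos hTQ]
      refine le_of_eq ?_
      have h1 : ent P (fun ω => (V' T ω, tuple V' (layersAboveContaining W T) ω)) =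
          ent P V := by
        refine ent_congr P fun ω ω' => ?_
        rw [Prod.mk.injEq, hV]
        simp [hV', hTc]
      have h2 : ent P (tuple V' (layersAboveContaining W T)) = 0 := by
        refine ent_const P _ fun ω ω' => ?_
        rw [hV]
        simp [hTc]
      have h3 : ent P (fun ω => (tuple V' Q ω, tuple V' (layersAbove L W) ω, X ω)) =
          ent P (fun ω => (X ω, V ω)) := by
        refine ent_congr P fun ω ω' => ?_
        rw [Prod.mk.injEq, Prod.mk.injEq, hV, hV]
        simp [hTa, hTQ, and_comm]
      have h4 : ent P (fun ω => (tuple V' (layersAbove L W) ω, X ω)) = ent P X := by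
        refine ent_congr P fun ω ω' => ?_
        rw [Prod.mk.injEq, hV]
        simp [hTa]
      have h5 := Finset.sum_eq_single_of_mem T hTQ hc
      refine (congrArg₂ (· - ·) h5 (congrArg₂ (· - ·) h3 h4)).trans ?_
      rw [h1, h2, hI]
      ring
    · rw [Finset.sum_ite_eq' Q T, if_neg hTQ]
      have h5 := Finset.sum_eq_zero fun S hS => hc S hS fun h => hTQ (h ▸ hS)
      have h3 : ent P (fun ω => (tuple V' Q ω, tuple V' (layersAbove L W) ω, X ω)) =
          ent P (fun ω => (tuple V' (layersAbove L W) ω, X ω)) := by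
        refine ent_congr P fun ω ω' => ?_
        rw [Prod.mk.injEq, hV]
        simp [hTQ]
      exact ((congrArg₂ (· - ·) h5 (sub_eq_zero.2 h3)).trans (sub_self 0)).le
  · intro S
    have h1 : ∀ K ∈ nonemptySubsets S.1, condEntropy P (U K)
        (fun ω => (tuple U (properSubsets K) ω, tuple V' (meeting K) ω)) =
        if (K ∩ T).Nonempty then
          ent P (fun ω => (U K ω, tuple U (properSubsets K) ω, V ω))
            - ent P (fun ω => (tuple U (properSubsets K) ω, V ω))
        else ent P (fun ω => (U K ω, tuple U (properSubsets K) ω))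
            - ent P (tuple U (properSubsets K)) := by
      intro K _
      rw [condEntropy_eq]
      split_ifs with h
      · refine congrArg₂ (· - ·) (ent_congr P fun ω ω' => ?_) (ent_congr P fun ω ω' => ?_)
        · rw [Prod.mk.injEq, Prod.mk.injEq, hV, hTm, Prod.mk.injEq, Prod.mk.injEq]
          simp only [h, true_imp_iff]
        · rw [Prod.mk.injEq, hV, hTm, Prod.mk.injEq]
          simp only [h, true_imp_iff]
      · refine congrArg₂ (· - ·) (ent_congr P fun ω ω' => ?_) (ent_congr P fun ω ω' => ?_)
        · rw [Prod.mk.injEq, Prod.mk.injEq, hV, hTm, Prod.mk.injEq]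
          simp only [h, false_imp_iff, and_true]
        · rw [Prod.mk.injEq, hV, hTm]
          simp only [h, false_imp_iff, and_true]
    have hTl : T ∈ layersAbove L 1 := by simp [layersAbove, hT]
    have h2 : condEntropy P (tuple U (nonemptySubsets S.1))
        (fun ω => (tuple V' (layersAbove L 1) ω, X ω)) =
        ent P (fun ω => (tuple U (nonemptySubsets S.1) ω, V ω, X ω))
        - ent P (fun ω => (V ω, X ω)) := by
      rw [condEntropy_eq]
      refine congrArg₂ (· - ·) (ent_congr P fun ω ω' => ?_) (ent_congr P fun ω ω' => ?_)
      · rw [Prod.mk.injEq, Prod.mk.injEq, hV, Prod.mk.injEq, Prod.mk.injEq]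
        simp only [hTl, true_imp_iff]
      · rw [Prod.mk.injEq, hV, Prod.mk.injEq]
        simp only [hTl, true_imp_iff]
    change (∑ K ∈ nonemptySubsets S.1, condEntropy P (U K)
      (fun ω => (tuple U (properSubsets K) ω, tuple V' (meeting K) ω))) -
      condEntropy P (tuple U (nonemptySubsets S.1))
        (fun ω => (tuple V' (layersAbove L 1) ω, X ω)) ≤ _
    rw [h2, Finset.sum_congr rfl h1, Finset.sum_sub_distrib, Finset.sum_ite_mem,
      Finset.sum_const, nsmul_eq_mul]
    have := hR S
    linarith
  · intro l
    have : ∑ K ∈ meeting {l}, (if K = T then I else 0) = if l ∈ T then I else 0 := by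
      rw [Finset.sum_ite_eq' (meeting {l}) T]
      have : T ∈ meeting {l} ↔ l ∈ T := by
        rw [hTm]
        simp [Finset.Nonempty, Finset.mem_inter]
      simp only [this]
    rw [this]
    linarith
  · intro S
    refine le_trans (le_of_eq ?_) (hD S)
    refine Finset.sum_congr rfl fun ω _ => ?_
    have := (hfac S).extend_apply (fun _ => g S ω₀) ω
    exact congrArg (fun z => (P ω).toReal * d S (X ω) z) this

end Regions

/-! ### VKG is contained in CMS -/

section Inclusion

theorem nonemptySubsets_singleton {L : ℕ} (c : Fin L) : nonemptySubsets {c} = {{c}} := by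
  ext K
  rw [mem_nonemptySubsets, Finset.mem_singleton]
  constructor
  · rintro ⟨h1, h2⟩
    exact (Finset.Nonempty.subset_singleton_iff h1).1 h2
  · rintro rfl
    simp

theorem properSubsets_singleton {L : ℕ} (c : Fin L) : properSubsets {c} = ∅ := by
  rw [properSubsets, nonemptySubsets_singleton, Finset.erase_singleton]

theorem vkgAchievable_subset_RDCMS {L : ℕ} {𝒳 : Type u} [Fintype 𝒳] (PX : PMF 𝒳)
    {Xhat : NESub L → Type v} (d : ∀ S : NESub L, 𝒳 → Xhat S → ℝ) :
    vkgAchievable PX d ⊆ RDCMS PX d := by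
  rintro t ⟨q, ψ, hR, hD⟩
  rcases Nat.lt_or_ge 1 L with hL | hL
  · refine mem_RDCMS_of_singleShared q.P q.X q.law_X q.V q.U Finset.univ (by simpa using hL)
      (fun S ω => ψ S (q.V ω, tuple q.U (nonemptySubsets S.1) ω)) ?_ ?_ hD
    · intro S ω ω' h1 h2
      rw [Finset.inter_univ] at h1
      rw [h1 S.2, (tuple_eq_iff _ _ _ _).2 h2]
    · intro S
      refine le_trans (le_of_eq ?_) (hR S)
      rw [VKGVars.rateBound, mutualInfo_eq, condEntropy_eq, Finset.inter_univ]
      have h1 : ∀ K ∈ nonemptySubsets S.1, (if (K ∩ Finset.univ).Nonempty then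
          ent q.P (fun ω => (q.U K ω, tuple q.U (properSubsets K) ω, q.V ω))
            - ent q.P (fun ω => (tuple q.U (properSubsets K) ω, q.V ω))
        else ent q.P (fun ω => (q.U K ω, tuple q.U (properSubsets K) ω))
            - ent q.P (tuple q.U (properSubsets K))) =
          condEntropy q.P (q.U K) (fun ω => (tuple q.U (properSubsets K) ω, q.V ω)) := by
        intro K hK
        rw [Finset.inter_univ, if_pos (mem_nonemptySubsets.1 hK).1, condEntropy_eq]
      have h2 : ent q.P (fun ω => (tuple q.U (nonemptySubsets S.1) ω, q.V ω, q.X ω)) =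
          ent q.P (fun ω => (tuple q.U (nonemptySubsets S.1) ω, q.X ω, q.V ω)) :=
        ent_congr _ fun ω ω' => by simp only [Prod.mk.injEq]; tauto
      have h3 : ent q.P (fun ω => (q.V ω, q.X ω)) = ent q.P (fun ω => (q.X ω, q.V ω)) :=
        ent_congr _ fun ω ω' => by simp only [Prod.mk.injEq]; tauto
      rw [Finset.sum_congr rfl h1, h2, h3]
      ring
  · have hsub : Subsingleton (Fin L) := Fin.subsingleton_iff_le_one.2 hL
    have hm : ∀ K : Finset (Fin L), meeting K = ∅ := by
      intro K
      refine Finset.eq_empty_of_forall_notMem fun S hS => ?_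
      have h1 := (mem_meeting.1 hS).1
      have h2 := Finset.card_le_univ S
      rw [Fintype.card_fin] at h2
      omega
    -- With at most one description, `V` becomes part of each private variable; the decoder reads it
    -- off the component indexed by `S` itself.
    refine mem_RDCMS_of_le ⟨q.Ω, q.P, q.X, q.law_X, fun _ => Unit, fun _ _ => (),
        fun K => q.AV × q.AU K, fun K ω => (q.V ω, q.U K ω)⟩
      (fun S z => ψ S ((z.2 ⟨S.1, mem_nonemptySubsets.2 ⟨S.2, subset_rfl⟩⟩).1,
        fun K => (z.2 K).2)) t.1 (fun _ => 0) ?_ ?_ ?_ hD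
    · intro W h1 h2
      omega
    · rintro ⟨S, hS⟩
      obtain ⟨c, hc⟩ := id hS
      obtain rfl : S = {c} := by
        ext x
        simp [Subsingleton.elim x c, hc]
      refine le_trans (le_of_eq ?_) (hR ⟨{c}, hS⟩)
      rw [VKGVars.rateBound]
      change (∑ K ∈ nonemptySubsets {c}, condEntropy q.P (fun ω => (q.V ω, q.U K ω))
        (fun ω => (tuple (fun K ω => (q.V ω, q.U K ω)) (properSubsets K) ω,
          tuple (fun (_ : Finset (Fin L)) (_ : q.Ω) => ()) (meeting K) ω))) -
        condEntropy q.P (tuple (fun K ω => (q.V ω, q.U K ω)) (nonemptySubsets {c}))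
          (fun ω => (tuple (fun (_ : Finset (Fin L)) (_ : q.Ω) => ()) (layersAbove L 1) ω, q.X ω))
        = _
      simp only [condEntropy_eq, mutualInfo_eq]
      rw [nonemptySubsets_singleton, Finset.sum_singleton, Finset.sum_singleton,
        properSubsets_singleton, hm, Finset.card_singleton]
      have e1 : ent q.P (fun ω => ((q.V ω, q.U {c} ω),
          tuple (fun K ω => (q.V ω, q.U K ω)) (∅ : Finset (Finset (Fin L))) ω,
          tuple (fun (_ : Finset (Fin L)) (_ : q.Ω) => ()) ∅ ω)) =
          ent q.P (fun ω => (q.V ω, q.U {c} ω)) :=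
        ent_congr _ fun ω ω' => by simp [tuple_eq_iff]
      have e2 : ent q.P (fun ω => (tuple (fun K ω => (q.V ω, q.U K ω))
          (∅ : Finset (Finset (Fin L))) ω,
          tuple (fun (_ : Finset (Fin L)) (_ : q.Ω) => ()) ∅ ω)) = 0 :=
        ent_const _ _ fun ω ω' => by simp [tuple_eq_iff]
      have e3 : ent q.P (fun ω => (tuple (fun K ω => (q.V ω, q.U K ω)) {{c}} ω,
          tuple (fun (_ : Finset (Fin L)) (_ : q.Ω) => ()) (layersAbove L 1) ω, q.X ω)) =
          ent q.P (fun ω => (tuple q.U {{c}} ω, q.X ω, q.V ω)) :=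
        ent_congr _ fun ω ω' => by
          simp only [Prod.mk.injEq, tuple_eq_iff, Finset.mem_singleton, forall_eq]
          tauto
      have e4 : ent q.P (fun ω => (tuple (fun (_ : Finset (Fin L)) (_ : q.Ω) => ())
          (layersAbove L 1) ω, q.X ω)) = ent q.P q.X :=
        ent_congr _ fun ω ω' => by simp [tuple_eq_iff]
      have e5 : ent q.P (fun ω => (q.U {c} ω, tuple q.U (∅ : Finset (Finset (Fin L))) ω,
          q.V ω)) = ent q.P (fun ω => (q.V ω, q.U {c} ω)) :=
        ent_congr _ fun ω ω' => by simp [tuple_eq_iff, and_comm]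
      have e6 : ent q.P (fun ω => (tuple q.U (∅ : Finset (Finset (Fin L))) ω, q.V ω)) =
          ent q.P q.V :=
        ent_congr _ fun ω ω' => by simp [tuple_eq_iff]
      rw [e1, e2, e3, e4, e5, e6]
      push_cast
      ring
    · intro l
      simp [hm]

theorem RDVKG_subset_RDCMS {L : ℕ} {𝒳 : Type u} [Fintype 𝒳] (PX : PMF 𝒳)
    {Xhat : NESub L → Type v} (d : ∀ S : NESub L, 𝒳 → Xhat S → ℝ) :
    RDVKG PX d ⊆ RDCMS PX d :=
  closure_minimal (vkgAchievable_subset_RDCMS PX d) isClosed_closure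

end Inclusion

/-! ### Lower bounds on the VKG region -/

section Converse

theorem nonemptySubsets_pair {L : ℕ} (a b : Fin L) :
    nonemptySubsets {a, b} = {{a}, {b}, {a, b}} := by
  ext K
  rw [mem_nonemptySubsets, ← Finset.coe_subset, ← Finset.coe_nonempty, Finset.coe_pair]
  simp only [Finset.mem_insert, Finset.mem_singleton, ← Finset.coe_inj, Finset.coe_singleton,
    Finset.coe_pair]
  constructor
  · rintro ⟨h1, h2⟩
    exact (Set.Nonempty.subset_pair_iff_eq h1).1 h2
  · rintro (h | h | h) <;> rw [h] <;> simp

theorem properSubsets_pair {L : ℕ} {a b : Fin L} (hab : a ≠ b) :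
    properSubsets {a, b} = {{a}, {b}} := by
  have h1 : ({a} : Finset (Fin L)) ≠ {a, b} := fun h => by
    have : b ∈ ({a} : Finset (Fin L)) := h ▸ by simp
    exact hab (Finset.mem_singleton.1 this).symm
  have h2 : ({b} : Finset (Fin L)) ≠ {a, b} := fun h => by
    have : a ∈ ({b} : Finset (Fin L)) := h ▸ by simp
    exact hab (Finset.mem_singleton.1 this)
  ext K
  rw [properSubsets, nonemptySubsets_pair]
  simp only [Finset.mem_erase, Finset.mem_insert, Finset.mem_singleton]
  constructor
  · tauto
  · rintro (rfl | rfl) <;> simp [h1, h2]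

theorem ent_pair_le {Ω A B : Type*} [Fintype Ω] (P : PMF Ω) (Y : Ω → A) (Z : Ω → B) :
    ent P (fun ω => (Y ω, Z ω)) ≤ ent P Y + ent P Z := by
  have := ent_submodular P (S := Y) (T := Z) (M := fun _ => ()) (J := fun ω => (Y ω, Z ω))
    (fun _ _ _ => rfl) (fun _ _ _ => rfl) (fun _ _ h1 h2 => by simp only [h1, h2])
  rwa [ent_const P (fun _ => ()) fun _ _ => rfl, add_zero] at this

/-- Conditional data processing, `I(f(Y, V); g(Z, V) | V) ≤ I(Y; Z | V)`. -/
theorem condMutualInfo_map_le {Ω C D E F G : Type*} [Fintype Ω] (P : PMF Ω) (Y : Ω → C)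
    (Z : Ω → D) (V : Ω → E) (f : C × E → F) (g : D × E → G) :
    ent P (fun ω => (V ω, f (Y ω, V ω))) + ent P (fun ω => (V ω, g (Z ω, V ω)))
        - ent P (fun ω => (V ω, f (Y ω, V ω), g (Z ω, V ω))) - ent P V ≤
      ent P (fun ω => (Y ω, V ω)) + ent P (fun ω => (Z ω, V ω))
        - ent P (fun ω => (Y ω, Z ω, V ω)) - ent P V := by
  have h1 := ent_submodular P (S := fun ω => (Y ω, V ω)) (T := fun ω => (V ω, f (Y ω, V ω), Z ω))
    (M := fun ω => (V ω, f (Y ω, V ω))) (J := fun ω => (Y ω, Z ω, V ω))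
    (fun ω ω' h => by simp_all) (fun ω ω' h => by simp only [Prod.mk.injEq] at h ⊢; tauto)
    (fun ω ω' h h' => by simp_all)
  have h2 := ent_submodular P (S := fun ω => (Z ω, V ω))
    (T := fun ω => (V ω, f (Y ω, V ω), g (Z ω, V ω)))
    (M := fun ω => (V ω, g (Z ω, V ω))) (J := fun ω => (V ω, f (Y ω, V ω), Z ω))
    (fun ω ω' h => by simp_all) (fun ω ω' h => by simp only [Prod.mk.injEq] at h ⊢; tauto)
    (fun ω ω' h h' => by simp_all)
  linarith

/-- The bound for one description is `I(X;V) + I(U_c;X|V)`, and the second term is nonnegative. This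
is where a rate near zero forces `V` to be nearly independent of the source. -/
theorem VKGVars.mutualInfo_le_rateBound_singleton {L : ℕ} {𝒳 : Type u} [Fintype 𝒳] {PX : PMF 𝒳}
    (q : VKGVars L PX) (c : Fin L) :
    ent q.P q.X + ent q.P q.V - ent q.P (fun ω => (q.V ω, q.X ω)) ≤ q.rateBound {c} := by
  rw [VKGVars.rateBound, nonemptySubsets_singleton, Finset.sum_singleton, properSubsets_singleton,
    Finset.card_singleton, mutualInfo_eq, condEntropy_eq, condEntropy_eq]
  have e1 : ent q.P (fun ω => (q.V ω, q.X ω)) = ent q.P (fun ω => (q.X ω, q.V ω)) :=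
    ent_congr _ fun ω ω' => by simp only [Prod.mk.injEq]; tauto
  have e2 : ent q.P (fun ω => (tuple q.U (∅ : Finset (Finset (Fin L))) ω, q.V ω)) =
      ent q.P q.V :=
    ent_congr _ fun ω ω' => by simp [tuple_eq_iff]
  have h := ent_submodular q.P
    (S := fun ω => (q.U {c} ω, tuple q.U (∅ : Finset (Finset (Fin L))) ω, q.V ω))
    (T := fun ω => (q.X ω, q.V ω)) (M := q.V)
    (J := fun ω => (tuple q.U {{c}} ω, q.X ω, q.V ω))
    (fun ω ω' h => by simp_all) (fun ω ω' h => by simp_all)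
    (fun ω ω' h h' => by
      simp only [Prod.mk.injEq, tuple_eq_iff, Finset.mem_singleton, forall_eq] at h h' ⊢
      tauto)
  rw [e1, e2]
  push_cast
  linarith

/-- The sum-rate bound of two descriptions:
`2 I(X; V) + H(X | V) - H(X | U_a, U_b, U_ab, V) + I(U_a; U_b | V)`. -/
theorem VKGVars.rateBound_pair {L : ℕ} {𝒳 : Type u} [Fintype 𝒳] {PX : PMF 𝒳}
    (q : VKGVars L PX) {a b : Fin L} (hab : a ≠ b) :
    q.rateBound {a, b} =
      2 * (ent q.P q.X + ent q.P q.V - ent q.P (fun ω => (q.V ω, q.X ω)))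
      + (ent q.P (fun ω => (q.V ω, q.X ω)) - ent q.P q.V)
      - (ent q.P (fun ω => (q.X ω, q.V ω, tuple q.U (nonemptySubsets {a, b}) ω))
        - ent q.P (fun ω => (q.V ω, tuple q.U (nonemptySubsets {a, b}) ω)))
      + (ent q.P (fun ω => (tuple q.U (nonemptySubsets {a}) ω, q.V ω))
        + ent q.P (fun ω => (tuple q.U (nonemptySubsets {b}) ω, q.V ω))
        - ent q.P (fun ω => (tuple q.U (nonemptySubsets {a}) ω, tuple q.U (nonemptySubsets {b}) ω, q.V ω)) - ent q.P q.V) := by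
  have n1 : ({a} : Finset (Fin L)) ∉ ({{b}, {a, b}} : Finset (Finset (Fin L))) := by
    intro h
    rw [Finset.mem_insert, Finset.mem_singleton] at h
    rcases h with h | h
    · exact hab (Finset.singleton_injective h)
    · have : b ∈ ({a} : Finset (Fin L)) := h ▸ by simp
      exact hab (Finset.mem_singleton.1 this).symm
  have n2 : ({b} : Finset (Fin L)) ∉ ({{a, b}} : Finset (Finset (Fin L))) := by
    intro h
    rw [Finset.mem_singleton] at h
    have : a ∈ ({b} : Finset (Fin L)) := h ▸ by simp
    exact hab (Finset.mem_singleton.1 this)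
  rw [VKGVars.rateBound, mutualInfo_eq, nonemptySubsets_pair, nonemptySubsets_singleton,
    nonemptySubsets_singleton, Finset.sum_insert n1,
    Finset.sum_insert n2, Finset.sum_singleton, properSubsets_singleton, properSubsets_singleton,
    properSubsets_pair hab, Finset.card_pair hab]
  simp only [condEntropy_eq]
  have e1 : ent q.P (fun ω => (q.V ω, q.X ω)) = ent q.P (fun ω => (q.X ω, q.V ω)) :=
    ent_congr _ fun ω ω' => by simp only [Prod.mk.injEq]; tauto
  have e2 : ent q.P (fun ω => (tuple q.U (∅ : Finset (Finset (Fin L))) ω, q.V ω)) =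
      ent q.P q.V :=
    ent_congr _ fun ω ω' => by simp [tuple_eq_iff]
  have e3 : ∀ c : Fin L, ent q.P (fun ω => (q.U {c} ω,
      tuple q.U (∅ : Finset (Finset (Fin L))) ω, q.V ω)) =
      ent q.P (fun ω => (tuple q.U {{c}} ω, q.V ω)) := fun c =>
    ent_congr _ fun ω ω' => by simp [tuple_eq_iff]
  have e4 : ent q.P (fun ω => (tuple q.U {{a}, {b}} ω, q.V ω)) =
      ent q.P (fun ω => (tuple q.U {{a}} ω, tuple q.U {{b}} ω, q.V ω)) :=
    ent_congr _ fun ω ω' => by simp [tuple_eq_iff, and_assoc]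
  have e5 : ent q.P (fun ω => (q.U {a, b} ω, tuple q.U {{a}, {b}} ω, q.V ω)) =
      ent q.P (fun ω => (q.V ω, tuple q.U {{a}, {b}, {a, b}} ω)) :=
    ent_congr _ fun ω ω' => by
      simp only [Prod.mk.injEq, tuple_eq_iff, Finset.mem_insert, Finset.mem_singleton,
        forall_eq_or_imp, forall_eq]
      tauto
  have e6 : ent q.P (fun ω => (tuple q.U {{a}, {b}, {a, b}} ω, q.X ω, q.V ω)) =
      ent q.P (fun ω => (q.X ω, q.V ω, tuple q.U {{a}, {b}, {a, b}} ω)) :=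
    ent_congr _ fun ω ω' => by simp only [Prod.mk.injEq]; tauto
  rw [e1, e2, e3, e3, e4, e5, e6]
  push_cast
  ring

/-- The entropy of a fair bit. -/
theorem ent_of_law_bernHalf {Ω : Type*} [Fintype Ω] (P : PMF Ω) (X : Ω → Bool)
    (h : P.map X = bernHalf) : ent P X = 1 := by
  have hp : ∀ x, prob P X x = 1 / 2 := fun x => by
    rw [prob, h]
    simp [bernHalf]
  rw [← entropy_eq_ent, entropy]
  simp only [hp, Fintype.sum_bool]
  rw [Real.logb_div one_ne_zero two_ne_zero, Real.logb_one, Real.logb_self_eq_one (by norm_num)]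
  norm_num

theorem expect_hamming_eq_prob {Ω : Type*} [Fintype Ω] (P : PMF Ω) (X Y : Ω → Bool) :
    expect P (fun ω => if X ω = Y ω then 0 else 1) =
      prob P (fun ω => decide (X ω = Y ω)) false := by
  rw [prob_eq_sum, expect]
  refine Finset.sum_congr rfl fun ω _ => ?_
  by_cases h : X ω = Y ω <;> simp [h]

theorem ent_bool_eq_binEntropy {Ω : Type*} [Fintype Ω] (P : PMF Ω) (E : Ω → Bool) :
    ent P E = Real.binEntropy (prob P E false) / Real.log 2 := by
  have h := sum_prob P E
  rw [Fintype.sum_bool] at h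
  rw [← entropy_eq_ent, entropy, Fintype.sum_bool, Real.binEntropy,
    ← eq_sub_iff_add_eq.2 h, Real.logb, Real.logb, Real.log_inv, Real.log_inv]
  ring

/-- Fano's inequality for a bit. -/
theorem condEntropy_le_binEntropy_error {Ω C : Type*} [Fintype Ω] (P : PMF Ω) (X : Ω → Bool)
    (Z : Ω → C) (g : C → Bool) :
    ent P (fun ω => (X ω, Z ω)) - ent P Z ≤
      Real.binEntropy (expect P fun ω => if X ω = g (Z ω) then 0 else 1) / Real.log 2 := by
  rw [expect_hamming_eq_prob, ← ent_bool_eq_binEntropy, sub_le_iff_le_add]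
  -- `Z` and the error indicator together determine the bit.
  refine le_trans (ent_mono P fun ω ω' h => ?_) (ent_pair_le P _ Z)
  simp only [Prod.mk.injEq, decide_eq_decide] at h ⊢
  refine ⟨?_, h.2⟩
  have h1 := h.1
  rw [h.2] at h1
  cases hX : X ω <;> cases hX' : X ω' <;> cases hg : g (Z ω) <;> simp_all

theorem vkgAchievable_bernHalf_tradeoff {L : ℕ} {a b c : Fin L} (hab : a ≠ b) {t : RDTuple L}
    (ht : t ∈ vkgAchievable bernHalf (hamming L))
    (hhalf : t.2 ⟨{a, b}, Finset.insert_nonempty a {b}⟩ ≤ 2⁻¹) {ε : ℝ} (hε : 0 < ε) :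
    34 / 25 ≤ t.1 a + t.1 b + t.2 ⟨{a}, Finset.singleton_nonempty a⟩
      + t.2 ⟨{b}, Finset.singleton_nonempty b⟩ + ε + t.1 c / (2 * ε)
      + Real.binEntropy (t.2 ⟨{a, b}, Finset.insert_nonempty a {b}⟩) / Real.log 2 := by
  obtain ⟨q, ψ, hR, hD⟩ := ht
  have hl0 : 0 < Real.log 2 := Real.log_pos (by norm_num)
  have hX : ent q.P q.X = 1 := ent_of_law_bernHalf q.P q.X q.law_X
  have hRc := (q.mutualInfo_le_rateBound_singleton c).trans
    (hR ⟨{c}, Finset.singleton_nonempty c⟩)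
  have hRab := hR ⟨{a, b}, Finset.insert_nonempty a {b}⟩
  rw [Finset.sum_singleton, hX] at hRc
  simp only at hRab
  rw [Finset.sum_pair hab, q.rateBound_pair hab, hX] at hRab
  have hDa := hD ⟨{a}, Finset.singleton_nonempty a⟩
  have hDb := hD ⟨{b}, Finset.singleton_nonempty b⟩
  have hDab := hD ⟨{a, b}, Finset.insert_nonempty a {b}⟩
  simp only [hamming] at hDa hDb hDab
  have hdp := condMutualInfo_map_le q.P (tuple q.U (nonemptySubsets {a}))
    (tuple q.U (nonemptySubsets {b})) q.V
    (fun z => ψ ⟨{a}, Finset.singleton_nonempty a⟩ (z.2, z.1))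
    (fun z => ψ ⟨{b}, Finset.singleton_nonempty b⟩ (z.2, z.1))
  have htr := condMutualInfo_tradeoff q.P q.X
    (fun ω => ψ ⟨{a}, Finset.singleton_nonempty a⟩ (q.V ω, tuple q.U (nonemptySubsets {a}) ω))
    (fun ω => ψ ⟨{b}, Finset.singleton_nonempty b⟩ (q.V ω, tuple q.U (nonemptySubsets {b}) ω))
    q.V hε
  have hfano := condEntropy_le_binEntropy_error q.P q.X
    (fun ω => (q.V ω, tuple q.U (nonemptySubsets {a, b}) ω))
    (ψ ⟨{a, b}, Finset.insert_nonempty a {b}⟩)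
  have herr : 0 ≤ expect q.P fun ω => if q.X ω = ψ ⟨{a, b}, Finset.insert_nonempty a {b}⟩
      (q.V ω, tuple q.U (nonemptySubsets {a, b}) ω) then 0 else 1 := by
    rw [expect_hamming_eq_prob]
    exact prob_nonneg _ _ _
  -- Binary entropy increases only on `[0, 1/2]`, hence the hypothesis `hhalf`.
  have hmono := div_le_div_of_nonneg_right (Real.binEntropy_strictMonoOn.monotoneOn
    ⟨herr, hDab.le.trans hhalf⟩ ⟨herr.trans hDab, hhalf⟩ hDab) hl0.le
  -- `I(X;V) ≥ 0`, so that `2 I(X;V) + H(X|V) = 1 + I(X;V)` is at least one.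
  have hI := ent_pair_le q.P q.V q.X
  rw [hX] at hI
  have hIc : (1 + ent q.P q.V - ent q.P (fun ω => (q.V ω, q.X ω))) / (2 * ε) ≤ t.1 c / (2 * ε) :=
    div_le_div_of_nonneg_right hRc (by positivity)
  linarith

end Converse

/-! ### Strict inclusion for the fair bit -/

section Strict

theorem RDVKG_bernHalf_tradeoff {L : ℕ} {a b c : Fin L} (hab : a ≠ b) {t : RDTuple L}
    (ht : t ∈ RDVKG bernHalf (hamming L)) (hc : t.1 c = 0)
    (hD : t.2 ⟨{a, b}, Finset.insert_nonempty a {b}⟩ = 0) :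
    34 / 25 ≤ t.1 a + t.1 b + t.2 ⟨{a}, Finset.singleton_nonempty a⟩
      + t.2 ⟨{b}, Finset.singleton_nonempty b⟩ := by
  obtain ⟨u, hu, hlim⟩ := mem_closure_iff_seq_limit.1 ht
  have hev : ∀ᶠ n in Filter.atTop,
      (u n).2 ⟨{a, b}, Finset.insert_nonempty a {b}⟩ ≤ 2⁻¹ := by
    have hcont : Continuous fun t : RDTuple L => t.2 ⟨{a, b}, Finset.insert_nonempty a {b}⟩ := by
      fun_prop
    have h := (hcont.tendsto t).comp hlim
    rw [hD] at h
    exact h.eventually (eventually_le_nhds (by norm_num))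
  -- For fixed `ε` the bound is continuous in the tuple, and in the limit both the `t.1 c / (2 * ε)`
  -- term and the entropy term vanish.
  refine le_of_forall_pos_le_add fun ε hε => ?_
  have hcont : Continuous fun t : RDTuple L => t.1 a + t.1 b
      + t.2 ⟨{a}, Finset.singleton_nonempty a⟩
      + t.2 ⟨{b}, Finset.singleton_nonempty b⟩ + ε + t.1 c / (2 * ε)
      + Real.binEntropy (t.2 ⟨{a, b}, Finset.insert_nonempty a {b}⟩) / Real.log 2 := by
    fun_prop
  have h := ge_of_tendsto ((hcont.tendsto t).comp hlim) (hev.mono fun n hn =>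
    vkgAchievable_bernHalf_tradeoff (c := c) hab (hu n) hn hε)
  simpa [hc, hD] using h

/-- Half the joint weights of the two codeword bits in the Zhang–Berger type test channel. -/
noncomputable def channelWeight : Bool → Bool → ℝ
  | true, true => 3 / 10
  | true, false => 3 / 40
  | false, true => 3 / 40
  | false, false => 1 / 20

theorem channelWeight_nonneg (a b : Bool) : 0 ≤ channelWeight a b := by
  cases a <;> cases b <;> norm_num [channelWeight]

/-- The law of `(v, a, b)`: a fair bit `v` independent of the codeword bits `a, b`. -/
noncomputable def channelLaw : PMF (Bool × Bool × Bool) :=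
  PMF.ofFintype (fun z => ENNReal.ofReal (channelWeight z.2.1 z.2.2)) (by
    rw [← ENNReal.ofReal_sum_of_nonneg fun z _ => channelWeight_nonneg _ _]
    simp only [Fintype.sum_prod_type, Fintype.sum_bool, channelWeight]
    norm_num)

theorem channelLaw_toReal (z : Bool × Bool × Bool) :
    (channelLaw z).toReal = channelWeight z.2.1 z.2.2 := by
  rw [channelLaw, PMF.ofFintype_apply, ENNReal.toReal_ofReal (channelWeight_nonneg _ _)]

/-- The source bit: `a ∧ b`, complemented when `v` is false. -/
def channelSource (z : Bool × Bool × Bool) : Bool := (z.2.1 && z.2.2) == z.1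

theorem channelLaw_map_source : channelLaw.map channelSource = bernHalf := by
  ext x
  refine (ENNReal.toReal_eq_toReal_iff' (PMF.apply_ne_top _ _) (PMF.apply_ne_top _ _)).1 ?_
  change prob channelLaw channelSource x = _
  rw [prob_eq_sum]
  simp only [channelLaw_toReal, Fintype.sum_prod_type, Fintype.sum_bool, channelSource]
  cases x <;> norm_num [channelWeight, bernHalf]

/-- Equivalent to `2 ^ 65 < 5 ^ 28`; sharp enough for the rate `529 / 1000`. -/
theorem logb_two_five_gt : 65 / 28 < Real.logb 2 5 := by
  rw [Real.lt_logb_iff_rpow_lt (by norm_num) (by norm_num)]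
  have h : ((2 : ℝ) ^ (65 / 28 : ℝ)) ^ (28 : ℕ) < 5 ^ (28 : ℕ) := by
    rw [← Real.rpow_natCast, ← Real.rpow_mul (by norm_num)]
    norm_num
  exact lt_of_pow_lt_pow_left₀ 28 (by norm_num) h

theorem logb_two_values :
    Real.logb 2 (3 / 10) = Real.logb 2 3 - 1 - Real.logb 2 5 ∧
    Real.logb 2 (3 / 40) = Real.logb 2 3 - 3 - Real.logb 2 5 ∧
    Real.logb 2 (1 / 20) = -2 - Real.logb 2 5 ∧
    Real.logb 2 (1 / 5) = -Real.logb 2 5 ∧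
    Real.logb 2 (3 / 8) = Real.logb 2 3 - 3 ∧
    Real.logb 2 (1 / 8) = -3 ∧ Real.logb 2 (1 / 2) = -1 := by
  have h2 : Real.logb 2 2 = 1 := Real.logb_self_eq_one (by norm_num)
  have h4 : Real.logb 2 4 = 2 := by
    rw [show (4 : ℝ) = 2 ^ 2 by norm_num, Real.logb_pow, h2]; norm_num
  have h8 : Real.logb 2 8 = 3 := by
    rw [show (8 : ℝ) = 2 ^ 3 by norm_num, Real.logb_pow, h2]; norm_num
  have h10 : Real.logb 2 10 = 1 + Real.logb 2 5 := by
    rw [show (10 : ℝ) = 2 * 5 by norm_num, Real.logb_mul (by norm_num) (by norm_num), h2]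
  have h20 : Real.logb 2 20 = 2 + Real.logb 2 5 := by
    rw [show (20 : ℝ) = 4 * 5 by norm_num, Real.logb_mul (by norm_num) (by norm_num), h4]
  have h40 : Real.logb 2 40 = 3 + Real.logb 2 5 := by
    rw [show (40 : ℝ) = 8 * 5 by norm_num, Real.logb_mul (by norm_num) (by norm_num), h8]
  refine ⟨?_, ?_, ?_, ?_, ?_, ?_, ?_⟩ <;>
    rw [Real.logb_div (by norm_num) (by norm_num)] <;>
    simp only [h2, h8, h10, h20, h40, Real.logb_one] <;> ring

/-- Entropy with respect to `channelLaw`, from the probabilities of the classes of `Z`. -/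
theorem ent_channelLaw {A : Type*} [DecidableEq A] (Z : Bool × Bool × Bool → A) :
    ent channelLaw Z = -∑ z, channelWeight z.2.1 z.2.2 *
      Real.logb 2 (∑ z', if Z z' = Z z then channelWeight z'.2.1 z'.2.2 else 0) := by
  simp only [ent, prob_eq_sum, channelLaw_toReal]

theorem ent_channel_shared : ent channelLaw (fun z => z.1) = 1 := by
  obtain ⟨-, -, -, -, -, -, h⟩ := logb_two_values
  rw [ent_channelLaw]
  simp only [Fintype.sum_prod_type, Fintype.sum_bool, channelWeight]
  norm_num [h]

theorem ent_channel_source_shared :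
    ent channelLaw (fun z => (z.1, channelSource z)) =
      -(3 / 5 * (Real.logb 2 3 - 1 - Real.logb 2 5) - 2 / 5 * Real.logb 2 5) := by
  obtain ⟨h1, h2, h3, h4, h5, h6, h7⟩ := logb_two_values
  rw [ent_channelLaw]
  simp only [Fintype.sum_prod_type, Fintype.sum_bool, channelWeight, channelSource]
  norm_num [h1, h4]
  ring

theorem ent_channel_first_shared :
    ent channelLaw (fun z => (z.2.1 == z.1, z.1)) =
      -(3 / 4 * (Real.logb 2 3 - 3) - 3 / 4) := by
  obtain ⟨h1, h2, h3, h4, h5, h6, h7⟩ := logb_two_values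
  rw [ent_channelLaw]
  simp only [Fintype.sum_prod_type, Fintype.sum_bool, channelWeight]
  norm_num [h5, h6]
  ring

theorem ent_channel_second_shared :
    ent channelLaw (fun z => (z.2.2 == z.1, z.1)) =
      -(3 / 4 * (Real.logb 2 3 - 3) - 3 / 4) := by
  obtain ⟨h1, h2, h3, h4, h5, h6, h7⟩ := logb_two_values
  rw [ent_channelLaw]
  simp only [Fintype.sum_prod_type, Fintype.sum_bool, channelWeight]
  norm_num [h5, h6]
  ring

theorem ent_channel_first_shared_source :
    ent channelLaw (fun z => (z.2.1 == z.1, z.1, channelSource z)) =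
      -(3 / 5 * (Real.logb 2 3 - 1 - Real.logb 2 5)
        + 3 / 20 * (Real.logb 2 3 - 3 - Real.logb 2 5) - 3 / 4) := by
  obtain ⟨h1, h2, h3, h4, h5, h6, h7⟩ := logb_two_values
  rw [ent_channelLaw]
  simp only [Fintype.sum_prod_type, Fintype.sum_bool, channelWeight, channelSource]
  norm_num [h1, h2, h6]
  ring

theorem ent_channel_second_shared_source :
    ent channelLaw (fun z => (z.2.2 == z.1, z.1, channelSource z)) =
      -(3 / 5 * (Real.logb 2 3 - 1 - Real.logb 2 5)
        + 3 / 20 * (Real.logb 2 3 - 3 - Real.logb 2 5) - 3 / 4) := by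
  obtain ⟨h1, h2, h3, h4, h5, h6, h7⟩ := logb_two_values
  rw [ent_channelLaw]
  simp only [Fintype.sum_prod_type, Fintype.sum_bool, channelWeight, channelSource]
  norm_num [h1, h2, h6]
  ring

theorem ent_channel_both_shared_source :
    ent channelLaw (fun z => (z.2.1 == z.1, z.2.2 == z.1, z.1, channelSource z)) =
      -(3 / 5 * (Real.logb 2 3 - 1 - Real.logb 2 5)
        + 3 / 10 * (Real.logb 2 3 - 3 - Real.logb 2 5) + 1 / 10 * (-2 - Real.logb 2 5)) := by
  obtain ⟨h1, h2, h3, h4, h5, h6, h7⟩ := logb_two_values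
  rw [ent_channelLaw]
  simp only [Fintype.sum_prod_type, Fintype.sum_bool, channelWeight, channelSource]
  norm_num [h1, h2, h3]
  ring

theorem expect_hamming_le_one {Ω : Type*} [Fintype Ω] (P : PMF Ω) (X Y : Ω → Bool) :
    expect P (fun ω => if X ω = Y ω then 0 else 1) ≤ 1 := by
  refine le_trans ?_ (sum_toReal_pmf P).le
  refine Finset.sum_le_sum fun ω _ => mul_le_of_le_one_right ENNReal.toReal_nonneg ?_
  dsimp only
  split_ifs <;> norm_num

theorem exists_mem_RDCMS_bernHalf {L : ℕ} {i j : Fin L} (hij : i ≠ j) :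
    ((fun l => if l ∈ ({i, j} : Finset (Fin L)) then 529 / 1000 else 0,
      fun S => if S.1 = {i} then 3 / 20 else if S.1 = {j} then 3 / 20 else
        if S.1 = {i, j} then 0 else 1) : RDTuple L) ∈ RDCMS bernHalf (hamming L) := by
  classical
  have hne : ({i} : Finset (Fin L)) ≠ {j} := fun h => hij (Finset.singleton_injective h)
  set U : Finset (Fin L) → Bool × Bool × Bool → Bool := fun K z =>
    if K = {i} then z.2.1 == z.1 else if K = {j} then z.2.2 == z.1 else false with hU
  have hUi : ∀ z, U {i} z = (z.2.1 == z.1) := fun z => by simp [hU]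
  have hUj : ∀ z, U {j} z = (z.2.2 == z.1) := fun z => by simp [hU, hne.symm]
  have hUo : ∀ K z, K ≠ {i} → K ≠ {j} → U K z = false := fun K z h1 h2 => by simp [hU, h1, h2]
  -- Each private variable is a codeword bit masked by the shared bit and serves directly as a
  -- reconstruction. Both of them with the shared bit reveal `a, b, v`, hence the source. All other
  -- sets of descriptions guess `false`.
  refine mem_RDCMS_of_singleShared channelLaw channelSource channelLaw_map_source (fun z => z.1)
    (AU := fun _ => Bool) U {i, j} (by rw [Finset.card_pair hij]; norm_num)
    (fun S z => if S.1 = {i} then z.2.1 == z.1 else if S.1 = {j} then z.2.2 == z.1 else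
      if S.1 = {i, j} then channelSource z else false) ?_ ?_ ?_
  · rintro S z z' hV hK
    by_cases h1 : S.1 = {i}
    · have := hK {i} (by rw [h1, nonemptySubsets_singleton]; simp)
      rw [hUi, hUi] at this
      simp only [h1, if_true, this]
    · by_cases h2 : S.1 = {j}
      · have := hK {j} (by rw [h2, nonemptySubsets_singleton]; simp)
        rw [hUj, hUj] at this
        simp only [h2, hne.symm, if_true, if_false, this]
      · by_cases h3 : S.1 = {i, j}
        · have e1 := hK {i} (by rw [h3, nonemptySubsets_pair]; simp)
          have e2 := hK {j} (by rw [h3, nonemptySubsets_pair]; simp)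
          have e3 := hV (by rw [h3, Finset.inter_self]; simp)
          rw [hUi, hUi] at e1
          rw [hUj, hUj] at e2
          obtain ⟨v, a, b⟩ := z
          obtain ⟨v', a', b'⟩ := z'
          simp only at e1 e2 e3
          subst e3
          have e1' : a = a' := by revert e1; cases a <;> cases a' <;> cases v <;> simp
          have e2' : b = b' := by revert e2; cases b <;> cases b' <;> cases v <;> simp
          rw [e1', e2']
        · simp only [h1, h2, h3, if_false]
  · rintro ⟨S, hS⟩
    have hX := ent_of_law_bernHalf _ _ channelLaw_map_source
    have hXV : ent channelLaw (fun z => (channelSource z, z.1)) =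
        ent channelLaw (fun z => (z.1, channelSource z)) :=
      ent_congr _ fun z z' => by simp only [Prod.mk.injEq]; tauto
    set h₁ := ent channelLaw (fun z => (z.2.1 == z.1, z.1)) - ent channelLaw (fun z => z.1)
      with hh₁
    have hterm : ∀ K ∈ nonemptySubsets S, (if (K ∩ {i, j}).Nonempty then
          ent channelLaw (fun z => (U K z, tuple U (properSubsets K) z, z.1))
            - ent channelLaw (fun z => (tuple U (properSubsets K) z, z.1))
        else ent channelLaw (fun z => (U K z, tuple U (properSubsets K) z))
            - ent channelLaw (tuple U (properSubsets K))) =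
        (if K = {i} then h₁ else 0) + (if K = {j} then h₁ else 0) := by
      intro K _
      by_cases h1 : K = {i}
      · subst h1
        rw [if_pos (by simp), if_pos rfl, if_neg hne, add_zero, properSubsets_singleton]
        refine congrArg₂ (· - ·) (ent_congr _ fun z z' => ?_) (ent_congr _ fun z z' => ?_)
        · simp only [Prod.mk.injEq, tuple_eq_iff, hUi]
          simp
        · simp [tuple_eq_iff]
      · by_cases h2 : K = {j}
        · subst h2
          rw [if_pos (by simp), if_pos rfl, if_neg hne.symm, zero_add, properSubsets_singleton,
            hh₁, ent_channel_first_shared, ← ent_channel_second_shared]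
          refine congrArg₂ (· - ·) (ent_congr _ fun z z' => ?_) (ent_congr _ fun z z' => ?_)
          · simp only [Prod.mk.injEq, tuple_eq_iff, hUj]
            simp
          · simp [tuple_eq_iff]
        · rw [if_neg h1, if_neg h2, add_zero]
          split_ifs
          · exact sub_eq_zero.2 (ent_congr _ fun z z' => by simp [hUo K _ h1 h2])
          · exact sub_eq_zero.2 (ent_congr _ fun z z' => by simp [hUo K _ h1 h2])
    have hmem : ∀ c : Fin L, ({c} ∈ nonemptySubsets S) ↔ c ∈ S := fun c => by
      simp [mem_nonemptySubsets]
    have htup : ∀ z z', tuple U (nonemptySubsets S) z' = tuple U (nonemptySubsets S) z ↔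
        (i ∈ S → (z'.2.1 == z'.1) = (z.2.1 == z.1)) ∧
        (j ∈ S → (z'.2.2 == z'.1) = (z.2.2 == z.1)) := by
      intro z z'
      rw [tuple_eq_iff]
      constructor
      · intro h
        refine ⟨fun hi => ?_, fun hj => ?_⟩
        · have := h {i} ((hmem i).2 hi)
          rwa [hUi, hUi] at this
        · have := h {j} ((hmem j).2 hj)
          rwa [hUj, hUj] at this
      · rintro ⟨hi, hj⟩ K hK
        by_cases h1 : K = {i}
        · subst h1
          rw [hUi, hUi]
          exact hi ((hmem i).1 hK)
        · by_cases h2 : K = {j}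
          · subst h2
            rw [hUj, hUj]
            exact hj ((hmem j).1 hK)
          · rw [hUo K _ h1 h2, hUo K _ h1 h2]
    have hrates : ∑ l ∈ S, (if l ∈ ({i, j} : Finset (Fin L)) then (529 / 1000 : ℝ) else 0) =
        ((S ∩ {i, j}).card : ℝ) * (529 / 1000) := by
      rw [Finset.sum_ite_mem, Finset.sum_const, nsmul_eq_mul]
    simp only
    rw [hrates, Finset.sum_congr rfl hterm, Finset.sum_add_distrib, Finset.sum_ite_eq',
      Finset.sum_ite_eq', hX, hXV]
    simp only [hmem]
    -- In each nontrivial case `log₂ 3` cancels: the requirement is `57/10 - 2 log₂ 5 ≤ 2 * 0.529`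
    -- if `S` contains both `i` and `j`, and `11/5 - (3/4) log₂ 5 ≤ 0.529` if it contains one of
    -- them.
    have hlog := logb_two_five_gt
    by_cases hi : i ∈ S
    · by_cases hj : j ∈ S
      · have hcard : (S ∩ {i, j}).card = 2 := by
          rw [Finset.inter_eq_right.2 (by simp [Finset.insert_subset_iff, hi, hj]),
            Finset.card_pair hij]
        have e1 : ent channelLaw (fun z => (tuple U (nonemptySubsets S) z, z.1,
            channelSource z)) = ent channelLaw
              (fun z => (z.2.1 == z.1, z.2.2 == z.1, z.1, channelSource z)) :=
          ent_congr _ fun z z' => by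
            simp only [Prod.mk.injEq, htup, hi, hj, true_imp_iff, and_assoc]
        rw [e1, hcard, if_pos hi, if_pos hj, hh₁, ent_channel_both_shared_source,
          ent_channel_first_shared, ent_channel_source_shared, ent_channel_shared]
        push_cast
        linarith
      · have hcard : (S ∩ {i, j}).card = 1 := by
          rw [Finset.card_eq_one]
          refine ⟨i, ?_⟩
          ext x
          simp only [Finset.mem_inter, Finset.mem_insert, Finset.mem_singleton]
          constructor
          · rintro ⟨h, rfl | rfl⟩
            · rfl
            · exact absurd h hj
          · rintro rfl
            exact ⟨hi, Or.inl rfl⟩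
        have e1 : ent channelLaw (fun z => (tuple U (nonemptySubsets S) z, z.1,
            channelSource z)) = ent channelLaw
              (fun z => (z.2.1 == z.1, z.1, channelSource z)) :=
          ent_congr _ fun z z' => by
            simp only [Prod.mk.injEq, htup, hi, hj, true_imp_iff, false_imp_iff, and_true]
        rw [e1, hcard, if_pos hi, if_neg hj, hh₁, ent_channel_first_shared_source,
          ent_channel_first_shared, ent_channel_source_shared, ent_channel_shared]
        push_cast
        linarith
    · by_cases hj : j ∈ S
      · have hcard : (S ∩ {i, j}).card = 1 := by
          rw [Finset.card_eq_one]
          refine ⟨j, ?_⟩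
          ext x
          simp only [Finset.mem_inter, Finset.mem_insert, Finset.mem_singleton]
          constructor
          · rintro ⟨h, rfl | rfl⟩
            · exact absurd h hi
            · rfl
          · rintro rfl
            exact ⟨hj, Or.inr rfl⟩
        have e1 : ent channelLaw (fun z => (tuple U (nonemptySubsets S) z, z.1,
            channelSource z)) = ent channelLaw
              (fun z => (z.2.2 == z.1, z.1, channelSource z)) :=
          ent_congr _ fun z z' => by
            simp only [Prod.mk.injEq, htup, hi, hj, true_imp_iff, false_imp_iff, true_and]
        rw [e1, hcard, if_neg hi, if_pos hj, hh₁, ent_channel_second_shared_source,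
          ent_channel_first_shared, ent_channel_source_shared, ent_channel_shared]
        push_cast
        linarith
      · have hcard : (S ∩ {i, j}).card = 0 := by
          rw [Finset.card_eq_zero, Finset.eq_empty_iff_forall_notMem]
          intro x
          simp only [Finset.mem_inter, Finset.mem_insert, Finset.mem_singleton]
          rintro ⟨h, rfl | rfl⟩
          · exact hi h
          · exact hj h
        have e1 : ent channelLaw (fun z => (tuple U (nonemptySubsets S) z, z.1,
            channelSource z)) = ent channelLaw (fun z => (z.1, channelSource z)) :=
          ent_congr _ fun z z' => by
            simp only [Prod.mk.injEq, htup, hi, hj, false_imp_iff, true_and]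
        rw [e1, hcard, if_neg hi, if_neg hj]
        simp
  · rintro ⟨S, hS⟩
    by_cases h1 : S = {i}
    · subst h1
      refine le_of_eq ?_
      simp only [hamming, if_true, expect, channelLaw_toReal, Fintype.sum_prod_type,
        Fintype.sum_bool, channelSource, channelWeight]
      norm_num
    · by_cases h2 : S = {j}
      · subst h2
        refine le_of_eq ?_
        simp only [hamming, if_true, hne.symm, if_false, expect, channelLaw_toReal,
          Fintype.sum_prod_type, Fintype.sum_bool, channelSource, channelWeight]
        norm_num
      · by_cases h3 : S = {i, j}
        · simp only [h3, if_true, hamming, expect]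
          simp [← h3, h1, h2]
        · simp only [h1, h2, h3, if_false]
          exact expect_hamming_le_one _ _ _

theorem RDVKG_bernHalf_ssubset {L : ℕ} (hL : 2 < L) :
    RDVKG bernHalf (hamming L) ⊂ RDCMS bernHalf (hamming L) := by
  refine ⟨RDVKG_subset_RDCMS bernHalf (hamming L), fun hsub => ?_⟩
  have hij : (⟨0, by omega⟩ : Fin L) ≠ ⟨1, by omega⟩ := by simp
  have h := RDVKG_bernHalf_tradeoff (c := ⟨2, hL⟩) hij (hsub (exists_mem_RDCMS_bernHalf hij))
    (by simp) (by
      have e1 : ({⟨0, by omega⟩, ⟨1, by omega⟩} : Finset (Fin L)) ≠ {⟨0, by omega⟩} := fun h => by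
        have := congrArg Finset.card h
        rw [Finset.card_pair hij, Finset.card_singleton] at this
        omega
      have e2 : ({⟨0, by omega⟩, ⟨1, by omega⟩} : Finset (Fin L)) ≠ {⟨1, by omega⟩} := fun h => by
        have := congrArg Finset.card h
        rw [Finset.card_pair hij, Finset.card_singleton] at this
        omega
      simp only [e1, e2, if_true, if_false])
  -- The CMS point has `2 * 0.529 + 2 * 0.15 = 1.358 < 1.36`.
  norm_num at h

end Strict

end MDC

theorem theorem1 :
    (∀ (L : ℕ) (𝒳 : Type u) [Fintype 𝒳] (PX : PMF 𝒳)
      (Xhat : MDC.NESub L → Type v) [∀ S, Finite (Xhat S)]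
      (d : ∀ S : MDC.NESub L, 𝒳 → Xhat S → ℝ),
      MDC.RDVKG PX d ⊆ MDC.RDCMS PX d) ∧
    (∀ L : ℕ, 2 < L →
      MDC.RDVKG MDC.bernHalf (MDC.hamming L) ⊂ MDC.RDCMS MDC.bernHalf (MDC.hamming L)) := by
  exact ⟨fun _ _ _ PX _ _ d => MDC.RDVKG_subset_RDCMS PX d,
    fun _ hL => MDC.RDVKG_bernHalf_ssubset hL⟩
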